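/- For a nondegenerate triangle $ABC$ in the Euclidean plane with side lengths $a=BC$, $b=CA$, $c=AB$, and $n=1,\dots,10$, let $X_n$ be the point with barycentric coordinates $\bigl(f_n(a,b,c):f_n(b,c,a):f_n(c,a,b)\bigr)$, where $f_1=a$, $f_2=1$, $f_3=a^2(a^2-b^2-c^2)$, $f_4=(a^2+b^2-c^2)(a^2-b^2+c^2)$, $f_5=c^4-a^2b^2+b^4-a^2c^2-2b^2c^2$, $f_6=a^2$, $f_7=(a+b-c)(a-b+c)$, $f_8=a-b-c$, $f_9=a(a-b-c)$, $f_{10}=b+c$ (the incenter, centroid, circumcenter, orthocenter, nine-point center, symmedian point, Gergonne point, Nagel point, mittenpunkt and Spieker center). Let $D(i,j)$ be the distance between $X_i$ and $X_j$. Theorem. The following bounds hold for all triangles, and they are best possible: each lower (upper) bound is the infimum (supremum) of the ratio over all triangles for which its denominator is nonzero. Each inequality with a finite bound also holds in the form $m\,D(5,j)\le D(5,i)$, respectively $D(5,i)\le M\,D(5,j)$ (and each equality in the form $D(5,i)=k\,D(5,j)$), for all triangles, including those with $D(5,j)=0$. A bound $\infty$ means that the ratio is unbounded above. $0\le\frac{D(5,1)}{D(5,2)}\le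 3$; $\quad 0\le\frac{D(5,1)}{D(5,j)}\le 1$ for $j=3,4,8,9,10$; $\quad 0\le\frac{D(5,1)}{D(5,j)}\le\infty$ for $j=6,7$; $\frac{D(5,2)}{D(5,3)}=\frac{D(5,2)}{D(5,4)}=\frac13$; $\quad\frac13\le\frac{D(5,2)}{D(5,j)}\le\infty$ for $j=6,7$; $\quad\frac19\le\frac{D(5,2)}{D(5,8)}\le1$; $\quad\frac13\le\frac{D(5,2)}{D(5,j)}\le1$ for $j=9,10$; $\frac{D(5,3)}{D(5,4)}=1$; and for $i=3,4$: $\quad 1\le\frac{D(5,i)}{D(5,j)}\le\infty$ for $j=6,7$; $\quad\frac13\le\frac{D(5,i)}{D(5,8)}\le3$; $\quad1\le\frac{D(5,i)}{D(5,j)}\le3$ for $j=9,10$; $0\le\frac{D(5,6)}{D(5,7)}\le\infty$; $\quad0\le\frac{D(5,6)}{D(5,8)}\le1$; $\quad0\le\frac{D(5,6)}{D(5,9)}\le C_4$; $\quad0\le\frac{D(5,6)}{D(5,10)}\le C_5$; $\quad0\le\frac{D(5,7)}{D(5,j)}\le1$ for $j=8,9,10$; $1\le\frac{D(5,8)}{D(5,j)}\le3$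 for $j=9,10$; $\quad1\le\frac{D(5,9)}{D(5,10)}\le7-4\sqrt2$. Here $C_4\approx1.053322135$ is the unique positive root of $6137x^5+5335x^4+678x^3-3702x^2-9479x-1225$ and $C_5\approx1.194505073$ is the unique positive root of $x^4+2x^3+22x^2-30x-1$ (both approximations with error less than $10^{-9}$); $C_4$ and $C_5$ are algebraic numbers of degree $5$ and $4$ over $\mathbb Q$. -/

import Mathlib

noncomputable section

namespace TriangleCenters

/-- The Euclidean plane. -/
abbrev Plane : Type := EuclideanSpace ℝ (Fin 2)

/-- The first barycentric coordinate `f (a, b, c)` of the triangle center `X_n`, `1 ≤ n ≤ 10`, in terms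
of the side lengths; the other two coordinates are `f (b, c, a)` and `f (c, a, b)`.
Only the values `n = 1, …, 10` have a meaning. -/
def firstCoord (n : ℕ) (a b c : ℝ) : ℝ :=
  match n with
  | 1 => a
  | 2 => 1
  | 3 => a ^ 2 * (a ^ 2 - b ^ 2 - c ^ 2)
  | 4 => (a ^ 2 + b ^ 2 - c ^ 2) * (a ^ 2 - b ^ 2 + c ^ 2)
  | 5 => c ^ 4 - a ^ 2 * b ^ 2 + b ^ 4 - a ^ 2 * c ^ 2 - 2 * b ^ 2 * c ^ 2
  | 6 => a ^ 2
  | 7 => (a + b - c) * (a - b + c)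
  | 8 => a - b - c
  | 9 => a * (a - b - c)
  | 10 => b + c
  | _ => 0

/-- The point with homogeneous barycentric coordinates `(u : v : w)` with respect to the triangle
`T` (meaningful when `u + v + w ≠ 0`). -/
def ofBarycentric (T : Affine.Triangle ℝ Plane) (u v w : ℝ) : Plane :=
  (u + v + w)⁻¹ • (u • T.points 0 + v • T.points 1 + w • T.points 2)

/-- The triangle center `X_n` of the (nondegenerate) triangle `T` with vertices `A = T.points 0`,
`B = T.points 1`, `C = T.points 2` and sides `a = BC`, `b = CA`, `c = AB`. -/
def center (n : ℕ) (T : Affine.Triangle ℝ Plane) : Plane :=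
  let a := dist (T.points 1) (T.points 2)
  let b := dist (T.points 2) (T.points 0)
  let c := dist (T.points 0) (T.points 1)
  ofBarycentric T (firstCoord n a b c) (firstCoord n b c a) (firstCoord n c a b)

/-- `D T i j` is the distance between the centers `X_i` and `X_j` of `T`. -/
def D (T : Affine.Triangle ℝ Plane) (i j : ℕ) : ℝ := dist (center i T) (center j T)

/-- All values of the ratio `D(n,i) / D(n,j)`, over all triangles for which it is defined. -/
def ratios (n i j : ℕ) : Set ℝ :=
  {x | ∃ T : Affine.Triangle ℝ Plane, D T n j ≠ 0 ∧ x = D T n i / D T n j}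

/-- `m ≤ D(n,i) / D(n,j)` for all triangles, and `m` is best possible. Where the denominator
vanishes, the inequality is read as `m * D(n,j) ≤ D(n,i)`. -/
def BestLower (n i j : ℕ) (m : ℝ) : Prop :=
  (∀ T : Affine.Triangle ℝ Plane, m * D T n j ≤ D T n i) ∧ IsGLB (ratios n i j) m

/-- `D(n,i) / D(n,j) ≤ M` for all triangles, and `M` is best possible. Where the denominator
vanishes, the inequality is read as `D(n,i) ≤ M * D(n,j)`. -/
def BestUpper (n i j : ℕ) (M : ℝ) : Prop :=
  (∀ T : Affine.Triangle ℝ Plane, D T n i ≤ M * D T n j) ∧ IsLUB (ratios n i j) M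

/-- `D(n,i) / D(n,j)` admits no finite upper bound (the best upper bound is `∞`). -/
def NoUpper (n i j : ℕ) : Prop := ¬ BddAbove (ratios n i j)

/-- `D(n,i) / D(n,j) = k` for all triangles. -/
def ConstRatio (n i j : ℕ) (k : ℝ) : Prop :=
  (∀ T : Affine.Triangle ℝ Plane, D T n i = k * D T n j) ∧ ratios n i j = {k}

end TriangleCenters

end

/-! Measure lengths in units of the circumradius `R` and put `ρ = r / R`, `σ = (s / R) ^ 2`. The
squared distance from the nine-point center to each other center is then an explicit function
`sqDist n ρ σ` (`D_five_sq_eq_sqDist`). For fixed `ρ`, the fundamental inequality confines `σ` to an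
interval whose endpoints belong to the two isosceles triangles with that `ρ`; their parameters are
`m` and `1 - m` (`exists_params`).

For every center except the symmedian point, `sqDist` is affine in `σ`. A comparison of two such
centers therefore holds for all triangles once it holds for isosceles ones
(`mul_D_le_of_axisCoord`). For the symmedian point the dependence on `σ` is rational, and
monotonicity replaces affinity. Its distance grows with `σ`, while the distances of the centroid,
circumcenter, orthocenter, mittenpunkt and Spieker center do not, so the upper endpoint is the worst
case (`mul_D_six_le_of_axisCoord`). The squared Nagel distance grows at least as fast, so there the
lower endpoint decides (`D_six_le_D_eight`).

In an isosceles triangle all centers lie on the axis of symmetry, and their distances share the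
factor `|2 * m - 1| / 2`. Ratios thus become quotients of the rational functions `|axisCoord n m|`,
and the inequalities involve one variable. Sharpness follows by evaluating at some `a` in `[0, 1]`:
the degenerate triangles `0`, `1` and the equilateral one `1 / 2` enter as limits
(`abs_div_abs_mem_closure_ratios`). Unboundedness comes from zeros of `axisCoord 6` and `axisCoord
7` (`noUpper_of_axisCoord`).

The two exotic constants are maxima of such quotients. Eliminating the critical point gives their
polynomials, and irreducibility modulo 11 and 17 gives their degrees. -/

/-! ### Irreducibility by reduction modulo a prime -/

open Polynomial in
/-- Division of a polynomial of degree at most five by a monic quadratic polynomial. -/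
lemma quintic_eq_quadratic_mul_add {K : Type*} [CommRing K] (c₅ c₄ c₃ c₂ c₁ c₀ u v : K) :
    (C c₅ * X ^ 5 + C c₄ * X ^ 4 + C c₃ * X ^ 3 + C c₂ * X ^ 2 + C c₁ * X + C c₀ : K[X]) =
      (X ^ 2 + C u * X + C v) * (C c₅ * X ^ 3 + C (c₄ - u * c₅) * X ^ 2
        + C (c₃ - u * (c₄ - u * c₅) - v * c₅) * X
        + C (c₂ - u * (c₃ - u * (c₄ - u * c₅) - v * c₅) - v * (c₄ - u * c₅)))
      + (C (c₁ - u * (c₂ - u * (c₃ - u * (c₄ - u * c₅) - v * c₅) - v * (c₄ - u * c₅))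
          - v * (c₃ - u * (c₄ - u * c₅) - v * c₅)) * X
        + C (c₀ - v * (c₂ - u * (c₃ - u * (c₄ - u * c₅) - v * c₅) - v * (c₄ - u * c₅)))) := by
  simp only [map_sub, map_mul]
  ring

open Polynomial in
/-- A polynomial of degree four or five without roots and without quadratic factors is irreducible. -/
lemma irreducible_quintic_of_no_factor {K : Type*} [CommRing K] (hK : IsField K)
    (c₅ c₄ c₃ c₂ c₁ c₀ : K) {f : K[X]}
    (hf : f = C c₅ * X ^ 5 + C c₄ * X ^ 4 + C c₃ * X ^ 3 + C c₂ * X ^ 2 + C c₁ * X + C c₀)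
    (hdeg : f.natDegree = 4 ∨ f.natDegree = 5)
    (hroot : ∀ x : K, c₅ * x ^ 5 + c₄ * x ^ 4 + c₃ * x ^ 3 + c₂ * x ^ 2 + c₁ * x + c₀ ≠ 0)
    (hquad : ∀ u v : K, c₀ - v * (c₂ - u * (c₃ - u * (c₄ - u * c₅) - v * c₅) - v * (c₄ - u * c₅)) = 0 →
      c₁ - u * (c₂ - u * (c₃ - u * (c₄ - u * c₅) - v * c₅) - v * (c₄ - u * c₅))
          - v * (c₃ - u * (c₄ - u * c₅) - v * c₅) ≠ 0) :
    Irreducible f := by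
  let _ : Field K := hK.toField
  have hf0 : f ≠ 0 := by
    rintro rfl
    simp at hdeg
  have hfu : ¬ IsUnit f := fun h => by
    have := natDegree_eq_zero_of_isUnit h
    omega
  rw [irreducible_iff_lt_natDegree_lt hf0 hfu]
  intro q hq hqd hdvd
  -- Only monic factors of at most half the degree, rounded down, need to be excluded.
  have h12 : q.natDegree = 1 ∨ q.natDegree = 2 := by
    rw [Finset.mem_Ioc] at hqd
    omega
  rcases h12 with h1 | h2
  · have hqe : q = X - C (-q.coeff 0) := by
      conv_lhs => rw [hq.eq_X_add_C h1]
      simp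
    rw [hqe, dvd_iff_isRoot, hf] at hdvd
    apply hroot (-q.coeff 0)
    simpa using hdvd
  · have hqe : q = X ^ 2 + C (q.coeff 1) * X + C (q.coeff 0) := by
      conv_lhs => rw [hq.as_sum, h2]
      simp [Finset.sum_range_succ]
      ring
    rw [hf, quintic_eq_quadratic_mul_add c₅ c₄ c₃ c₂ c₁ c₀ (q.coeff 1) (q.coeff 0), ← hqe] at hdvd
    -- A divisor of `f` divides the remainder, which has degree at most one and so vanishes; its two
    -- coefficients contradict `hquad`.
    rw [dvd_add_right (dvd_mul_right _ _)] at hdvd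
    have hz := eq_zero_of_dvd_of_natDegree_lt hdvd (by
      rw [h2]
      exact lt_of_le_of_lt natDegree_linear_le one_lt_two)
    apply hquad (q.coeff 1) (q.coeff 0)
    · simpa using congrArg (fun p => coeff p 0) hz
    · have h := congrArg (fun p => coeff p 1) hz
      simpa [coeff_C] using h

-- A factor that becomes a unit modulo `p` is constant, because its leading coefficient survives the
-- reduction; primitivity then makes this constant a unit of `ℤ`.
open Polynomial in
lemma irreducible_of_irreducible_map_zmod {f : ℤ[X]} (hf : f.IsPrimitive) (p : ℕ) [Fact p.Prime]
    (hlc : (f.leadingCoeff : ZMod p) ≠ 0) (hirr : Irreducible (f.map (Int.castRingHom (ZMod p)))) :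
    Irreducible f := by
  have key : ∀ a b : ℤ[X], f = a * b → IsUnit (a.map (Int.castRingHom (ZMod p))) → IsUnit a := by
    intro a b hab ha
    have hla : (Int.castRingHom (ZMod p)) a.leadingCoeff ≠ 0 := by
      intro h
      apply hlc
      rw [hab, leadingCoeff_mul, Int.cast_mul]
      simp only [eq_intCast] at h
      rw [h, zero_mul]
    have h0 : a.natDegree = 0 := by
      rw [← natDegree_map_of_leadingCoeff_ne_zero _ hla]
      exact natDegree_eq_zero_of_isUnit ha
    rw [eq_C_of_natDegree_eq_zero h0] at hab ⊢
    exact (hf _ ⟨b, hab⟩).map C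
  refine ⟨fun h => hirr.not_isUnit (h.map (mapRingHom _)), fun a b hab => ?_⟩
  have hm : f.map (Int.castRingHom (ZMod p)) =
      a.map (Int.castRingHom (ZMod p)) * b.map (Int.castRingHom (ZMod p)) := by
    rw [hab, Polynomial.map_mul]
  rcases hirr.isUnit_or_isUnit hm with h | h
  · exact .inl (key a b hab h)
  · exact .inr (key b a (hab.trans (mul_comm a b)) h)

open Polynomial in
/-- The degree of a real root of an irreducible integer polynomial. -/
lemma natDegree_minpoly_of_irreducible {f : ℤ[X]} (hirr : Irreducible f) (hprim : f.IsPrimitive) {x : ℝ}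
    (hx : aeval x f = 0) : (minpoly ℚ x).natDegree = f.natDegree := by
  have h := (IsPrimitive.Int.irreducible_iff_irreducible_map_cast hprim).1 hirr
  have hroot : aeval x (f.map (Int.castRingHom ℚ)) = 0 := by
    have : aeval x (f.map (algebraMap ℤ ℚ)) = 0 := by rw [aeval_map_algebraMap, hx]
    simpa using this
  rw [← minpoly.eq_of_irreducible h hroot, natDegree_mul_C, natDegree_map_eq_of_injective]
  · exact (Int.castRingHom ℚ).injective_int
  · exact inv_ne_zero (leadingCoeff_ne_zero.2 h.ne_zero)

lemma isField_zmod (p : ℕ) [Fact p.Prime] :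
    @IsField (ZMod p) (ZMod.commRing p).toCommSemiring.toSemiring :=
  Field.toIsField (ZMod p)

/-- Irreducibility modulo 11 is a finite check: no root here, no quadratic factor in the next lemma.
The prime 17 plays this role for the quartic. -/
lemma quintic_no_root_zmod (x : ZMod 11) :
    6137 * x ^ 5 + 5335 * x ^ 4 + 678 * x ^ 3 + -3702 * x ^ 2 + -9479 * x + -1225 ≠ 0 := by
  revert x; decide

lemma quintic_no_quadratic_factor_zmod : ∀ (u v : ZMod 11),
    -1225 - v * (-3702 - u * (678 - u * (5335 - u * 6137) - v * 6137) - v * (5335 - u * 6137)) = 0 →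
      -9479 - u * (-3702 - u * (678 - u * (5335 - u * 6137) - v * 6137) - v * (5335 - u * 6137)) -
          v * (678 - u * (5335 - u * 6137) - v * 6137) ≠ 0 := by
  decide

lemma quartic_no_root_zmod (x : ZMod 17) :
    0 * x ^ 5 + 1 * x ^ 4 + 2 * x ^ 3 + 22 * x ^ 2 + -30 * x + -1 ≠ 0 := by
  revert x; decide

lemma quartic_no_quadratic_factor_zmod : ∀ (u v : ZMod 17),
    -1 - v * (22 - u * (2 - u * (1 - u * 0) - v * 0) - v * (1 - u * 0)) = 0 →
      -30 - u * (22 - u * (2 - u * (1 - u * 0) - v * 0) - v * (1 - u * 0))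
        - v * (2 - u * (1 - u * 0) - v * 0) ≠ 0 := by
  decide

open Polynomial in
lemma natDegree_minpoly_quintic {x : ℝ}
    (hx : 6137 * x ^ 5 + 5335 * x ^ 4 + 678 * x ^ 3 - 3702 * x ^ 2 - 9479 * x - 1225 = 0) :
    (minpoly ℚ x).natDegree = 5 := by
  set f : ℤ[X] := C 6137 * X ^ 5 + C 5335 * X ^ 4 + C 678 * X ^ 3 + C (-3702) * X ^ 2
    + C (-9479) * X + C (-1225) with hf
  have hdeg : f.natDegree = 5 := by
    rw [hf]
    compute_degree!
  have hc5 : f.coeff 5 = 6137 := by simp [hf, coeff_X]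
  have hc0 : f.coeff 0 = -1225 := by simp [hf]
  have hprim : f.IsPrimitive := by
    intro r hr
    rw [C_dvd_iff_dvd_coeff] at hr
    have h5 := hr 5
    have h0 := hr 0
    rw [hc5] at h5
    rw [hc0] at h0
    refine isUnit_of_dvd_one ?_
    -- A Bézout relation: the leading and constant coefficients are already coprime.
    have h1 : (1 : ℤ) = 6137 * (-102) + (-1225) * (-511) := by norm_num
    rw [h1]
    exact dvd_add (h5.mul_right _) (h0.mul_right _)
  have h11 : ((6137 : ℤ) : ZMod 11) ≠ 0 := by decide
  have hmap : f.map (Int.castRingHom (ZMod 11)) = C 6137 * X ^ 5 + C 5335 * X ^ 4 + C 678 * X ^ 3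
      + C (-3702) * X ^ 2 + C (-9479) * X + C (-1225) := by
    simp only [hf, Polynomial.map_add, Polynomial.map_mul, Polynomial.map_pow, Polynomial.map_C, map_X]
    simp only [eq_intCast]
    push_cast
    rfl
  have : Fact (Nat.Prime 11) := ⟨by norm_num⟩
  have hlc : f.leadingCoeff = 6137 := by rw [leadingCoeff, hdeg, hc5]
  have hirr : Irreducible f := by
    refine irreducible_of_irreducible_map_zmod hprim 11 ?_ ?_
    · rw [hlc]; exact h11
    · refine irreducible_quintic_of_no_factor (isField_zmod 11)
        (6137 : ZMod 11) 5335 678 (-3702) (-9479) (-1225) ?_ ?_ ?_ ?_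
      · exact hmap
      · right
        rw [natDegree_map_of_leadingCoeff_ne_zero, hdeg]
        rw [hlc]; exact h11
      · exact quintic_no_root_zmod
      · exact quintic_no_quadratic_factor_zmod
  rw [natDegree_minpoly_of_irreducible hirr hprim, hdeg]
  simp only [hf, map_add, map_mul, map_pow, aeval_X, aeval_C, map_neg]
  simp only [eq_intCast]
  push_cast
  linarith

open Polynomial in
lemma natDegree_minpoly_quartic {x : ℝ} (hx : x ^ 4 + 2 * x ^ 3 + 22 * x ^ 2 - 30 * x - 1 = 0) :
    (minpoly ℚ x).natDegree = 4 := by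
  -- The zero coefficient in degree five puts the quartic in the shape of the criterion for
  -- quintics.
  set f : ℤ[X] := C 0 * X ^ 5 + C 1 * X ^ 4 + C 2 * X ^ 3 + C 22 * X ^ 2
    + C (-30) * X + C (-1) with hf
  have hdeg : f.natDegree = 4 := by
    rw [hf, C_0, zero_mul, zero_add]
    compute_degree!
  have hc4 : f.coeff 4 = 1 := by simp [hf, coeff_X, coeff_one]
  have hlc : f.leadingCoeff = 1 := by rw [leadingCoeff, hdeg, hc4]
  have hprim : f.IsPrimitive := Monic.isPrimitive hlc
  have hmap : f.map (Int.castRingHom (ZMod 17)) = C 0 * X ^ 5 + C 1 * X ^ 4 + C 2 * X ^ 3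
      + C 22 * X ^ 2 + C (-30) * X + C (-1) := by
    simp only [hf, Polynomial.map_add, Polynomial.map_mul, Polynomial.map_pow, Polynomial.map_C, map_X]
    simp only [eq_intCast]
    push_cast
    rfl
  have : Fact (Nat.Prime 17) := ⟨by norm_num⟩
  have hirr : Irreducible f := by
    refine irreducible_of_irreducible_map_zmod hprim 17 ?_ ?_
    · rw [hlc]; simp
    · refine irreducible_quintic_of_no_factor (isField_zmod 17)
        (0 : ZMod 17) 1 2 22 (-30) (-1) ?_ ?_ ?_ ?_
      · exact hmap
      · left
        rw [natDegree_map_of_leadingCoeff_ne_zero, hdeg]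
        rw [hlc]; simp
      · exact quartic_no_root_zmod
      · exact quartic_no_quadratic_factor_zmod
  rw [natDegree_minpoly_of_irreducible hirr hprim, hdeg]
  simp only [hf, map_add, map_mul, map_pow, aeval_X, aeval_C, map_neg]
  simp only [eq_intCast]
  push_cast
  linarith

/-! ### The two algebraic constants -/

/-- Divided by `x ^ 2`, the quintic is strictly increasing for `x > 0`: positive coefficients sit
above degree two, negative ones at degree two or below. This gives uniqueness of the positive root
and reduces decimal bounds to sign checks. -/
lemma quintic_mul_sq_lt {x y : ℝ} (hx : 0 < x) (hxy : x < y) :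
    (6137 * x ^ 5 + 5335 * x ^ 4 + 678 * x ^ 3 - 3702 * x ^ 2 - 9479 * x - 1225) * y ^ 2
      < (6137 * y ^ 5 + 5335 * y ^ 4 + 678 * y ^ 3 - 3702 * y ^ 2 - 9479 * y - 1225) * x ^ 2 := by
  obtain ⟨d, rfl⟩ : ∃ d, y = x + d := ⟨y - x, by ring⟩
  have hd : 0 < d := by linarith
  rw [← sub_pos]
  ring_nf
  positivity

/-- The same monotonicity for the quartic, here after division by `x`. -/
lemma quartic_mul_lt {x y : ℝ} (hx : 0 < x) (hxy : x < y) :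
    (x ^ 4 + 2 * x ^ 3 + 22 * x ^ 2 - 30 * x - 1) * y
      < (y ^ 4 + 2 * y ^ 3 + 22 * y ^ 2 - 30 * y - 1) * x := by
  obtain ⟨d, rfl⟩ : ∃ d, y = x + d := ⟨y - x, by ring⟩
  have hd : 0 < d := by linarith
  rw [← sub_pos]
  ring_nf
  positivity

/-- The maximum of the ratio of the distances from the nine-point center to the symmedian point and
to the Spieker center over isosceles triangles. -/
lemma exists_symmedian_spieker_const : ∃ C : ℝ,
    {x : ℝ | 0 < x ∧ x ^ 4 + 2 * x ^ 3 + 22 * x ^ 2 - 30 * x - 1 = 0} = {C} ∧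
    |C - 1.194505073| < 1 / 10 ^ 9 ∧ (minpoly ℚ C).natDegree = 4 ∧ 0 < C ∧
    (∃ m : ℝ, 0 < m ∧ m < 1 / 4 ∧ (2 * m + 1) * (1 - 2 * m ^ 2) = C * (1 + 2 * m ^ 2)) ∧
    ∀ m : ℝ, 0 < m → m < 1 → |(2 * m + 1) * (1 - 2 * m ^ 2)| ≤ C * (1 + 2 * m ^ 2) := by
  -- The quartic is, up to the factor `-2`, the numerator of the derivative of `(2 * m + 1) * (1 - 2
  -- * m ^ 2) / (1 + 2 * m ^ 2)`, so `k` is a critical point.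
  obtain ⟨k, ⟨hk0, hk1⟩, hk⟩ : ∃ k ∈ Set.Ioo (0 : ℝ) (1 / 4), 4 * k ^ 4 + 8 * k ^ 2 + 4 * k - 1 = 0 := by
    have hc : ContinuousOn (fun k : ℝ => 4 * k ^ 4 + 8 * k ^ 2 + 4 * k - 1) (Set.Icc 0 (1 / 4)) := by
      fun_prop
    exact intermediate_value_Ioo (by norm_num) hc ⟨by norm_num, by norm_num⟩
  have hden : 0 < 1 + 2 * k ^ 2 := by positivity
  obtain ⟨C, hC⟩ : ∃ C : ℝ, C * (1 + 2 * k ^ 2) = (2 * k + 1) * (1 - 2 * k ^ 2) :=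
    ⟨_, div_mul_cancel₀ _ hden.ne'⟩
  have hC1 : 1 < C := by
    have : 0 < (C - 1) * (1 + 2 * k ^ 2) := by
      have e : (C - 1) * (1 + 2 * k ^ 2) = 2 * k * (1 - 2 * k - 2 * k ^ 2) := by linear_combination hC
      rw [e]
      have : 0 < 1 - 2 * k - 2 * k ^ 2 := by nlinarith
      positivity
    linarith [pos_of_mul_pos_left this hden.le]
  have hroot : C ^ 4 + 2 * C ^ 3 + 22 * C ^ 2 - 30 * C - 1 = 0 := by
    have h4 : (C ^ 4 + 2 * C ^ 3 + 22 * C ^ 2 - 30 * C - 1) * (1 + 2 * k ^ 2) ^ 4 = 0 := by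
      have e : (C ^ 4 + 2 * C ^ 3 + 22 * C ^ 2 - 30 * C - 1) * (1 + 2 * k ^ 2) ^ 4 =
          (C * (1 + 2 * k ^ 2)) ^ 4 + 2 * (C * (1 + 2 * k ^ 2)) ^ 3 * (1 + 2 * k ^ 2)
          + 22 * (C * (1 + 2 * k ^ 2)) ^ 2 * (1 + 2 * k ^ 2) ^ 2
          - 30 * (C * (1 + 2 * k ^ 2)) * (1 + 2 * k ^ 2) ^ 3 - (1 + 2 * k ^ 2) ^ 4 := by ring
      rw [e, hC]
      -- After clearing denominators the expression is divisible by the critical-point polynomial;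
      -- the coefficient is the quotient.
      linear_combination (6 - 24 * k - 40 * k ^ 2 - 48 * k ^ 3 - 40 * k ^ 4 + 192 * k ^ 5
        + 96 * k ^ 6 + 64 * k ^ 7 + 64 * k ^ 8) * hk
    exact (mul_eq_zero.1 h4).resolve_right (by positivity)
  -- First-order condition: at `k`, the derivative of `C` times the denominator equals that of the
  -- numerator.
  have hder : C * (4 * k) = 2 - 4 * k - 12 * k ^ 2 := by
    have : (1 + 2 * k ^ 2) * (C * (4 * k)) = (1 + 2 * k ^ 2) * (2 - 4 * k - 12 * k ^ 2) := by
      linear_combination 4 * k * hC + 2 * hk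
    exact mul_left_cancel₀ hden.ne' this
  refine ⟨C, ?_, ?_, natDegree_minpoly_quartic hroot, by linarith, ⟨k, hk0, hk1, hC.symm⟩, ?_⟩
  · ext x
    simp only [Set.mem_ofPred_eq, Set.mem_singleton_iff]
    constructor
    · rintro ⟨hx, hxr⟩
      rcases lt_trichotomy x C with h | h | h
      · have := quartic_mul_lt hx h
        rw [hxr, hroot] at this
        simp at this
      · exact h
      · have := quartic_mul_lt (by linarith) h
        rw [hxr, hroot] at this
        simp at this
    · rintro rfl
      exact ⟨by linarith, hroot⟩
  · rw [abs_lt]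
    constructor
    · by_contra! h
      -- Monotonicity needs a strict inequality, so the polynomial is evaluated at a point strictly
      -- inside the claimed interval.
      have h' : C < 1.194505073 - 1 / 10 ^ 9 * (1 / 2) := by linarith
      have := quartic_mul_lt (by linarith) h'
      rw [hroot, zero_mul] at this
      have := pos_of_mul_pos_left this (by linarith)
      norm_num at this
    · by_contra! h
      have h' : 1.194505073 + 1 / 10 ^ 9 * (1 - 1 / 20) < C := by linarith
      have := quartic_mul_lt (by norm_num) h'
      rw [hroot, zero_mul] at this
      have := neg_of_mul_neg_left this (by linarith)
      norm_num at this
  · intro m hm0 hm1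
    rw [abs_le]
    constructor
    · nlinarith [mul_nonneg (sub_nonneg.2 hC1.le) (by positivity : 0 ≤ 1 + 2 * m ^ 2),
        mul_nonneg (by linarith : 0 ≤ 1 + m) (by nlinarith : 0 ≤ 1 - m ^ 2)]
    -- The value and the derivative of this cubic vanish at `k`, so `(m - k) ^ 2` splits off and the
    -- other factor is visibly positive.
    · have e : C * (1 + 2 * m ^ 2) - (2 * m + 1) * (1 - 2 * m ^ 2) =
          (m - k) ^ 2 * (4 * m + 8 * k + 2 + 2 * C) := by
        linear_combination hC + (m - k) * hder
      have : 0 ≤ (m - k) ^ 2 * (4 * m + 8 * k + 2 + 2 * C) := by positivity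
      linarith

/-- The maximum of the ratio of the distances from the nine-point center to the symmedian point and
to the mittenpunkt over isosceles triangles. -/
lemma exists_symmedian_mittenpunkt_const : ∃ C : ℝ,
    {x : ℝ | 0 < x ∧ 6137 * x ^ 5 + 5335 * x ^ 4 + 678 * x ^ 3 - 3702 * x ^ 2 - 9479 * x - 1225 = 0}
      = {C} ∧
    |C - 1.053322135| < 1 / 10 ^ 9 ∧ (minpoly ℚ C).natDegree = 5 ∧ 0 < C ∧
    (∃ m : ℝ, 0 < m ∧ m < 1 / 4 ∧ (2 * m + 1) * (1 - 2 * m ^ 2) * (2 - m)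
      = C * ((1 + 2 * m ^ 2) * (2 + m - 2 * m ^ 2))) ∧
    ∀ m : ℝ, 0 < m → m < 1 → |(2 * m + 1) * (1 - 2 * m ^ 2)| * (2 - m)
      ≤ C * ((1 + 2 * m ^ 2) * (2 + m - 2 * m ^ 2)) := by
  -- The critical-point equation again; the numerator of the derivative is `-4 * (1 + k)` times this
  -- quintic.
  obtain ⟨k, ⟨hk0, hk1⟩, hk⟩ : ∃ k ∈ Set.Ioo (0 : ℝ) (3 / 20),
      4 * k ^ 5 + 4 * k ^ 4 - 16 * k ^ 3 + 6 * k ^ 2 + 9 * k - 1 = 0 := by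
    have hc : ContinuousOn (fun k : ℝ => 4 * k ^ 5 + 4 * k ^ 4 - 16 * k ^ 3 + 6 * k ^ 2 + 9 * k - 1)
        (Set.Icc 0 (3 / 20)) := by
      fun_prop
    exact intermediate_value_Ioo (by norm_num) hc ⟨by norm_num, by norm_num⟩
  have hpos : ∀ m : ℝ, 0 < m → m < 1 → 0 < (1 + 2 * m ^ 2) * (2 + m - 2 * m ^ 2) := by
    intro m h0 h1
    have : 0 < 2 + m - 2 * m ^ 2 := by nlinarith
    positivity
  have hden := hpos k hk0 (by linarith)
  obtain ⟨C, hC⟩ : ∃ C : ℝ, C * ((1 + 2 * k ^ 2) * (2 + k - 2 * k ^ 2))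
      = (2 * k + 1) * (1 - 2 * k ^ 2) * (2 - k) :=
    ⟨_, div_mul_cancel₀ _ hden.ne'⟩
  have hC1 : 1 < C := by
    have : 0 < (C - 1) * ((1 + 2 * k ^ 2) * (2 + k - 2 * k ^ 2)) := by
      have e : (C - 1) * ((1 + 2 * k ^ 2) * (2 + k - 2 * k ^ 2))
          = 2 * k * (1 - 4 * k - 4 * k ^ 2 + 4 * k ^ 3) := by linear_combination hC
      rw [e]
      have h3 : 0 < k ^ 3 := by positivity
      have : 0 < 1 - 4 * k - 4 * k ^ 2 + 4 * k ^ 3 := by nlinarith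
      positivity
    linarith [pos_of_mul_pos_left this hden.le]
  have hroot : 6137 * C ^ 5 + 5335 * C ^ 4 + 678 * C ^ 3 - 3702 * C ^ 2 - 9479 * C - 1225 = 0 := by
    set d := (1 + 2 * k ^ 2) * (2 + k - 2 * k ^ 2) with hd
    have h5 : (6137 * C ^ 5 + 5335 * C ^ 4 + 678 * C ^ 3 - 3702 * C ^ 2 - 9479 * C - 1225) * d ^ 5 = 0 := by
      have e : (6137 * C ^ 5 + 5335 * C ^ 4 + 678 * C ^ 3 - 3702 * C ^ 2 - 9479 * C - 1225) * d ^ 5 =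
          6137 * (C * d) ^ 5 + 5335 * (C * d) ^ 4 * d + 678 * (C * d) ^ 3 * d ^ 2
          - 3702 * (C * d) ^ 2 * d ^ 3 - 9479 * (C * d) * d ^ 4 - 1225 * d ^ 5 := by ring
      rw [e, hC, hd]
      linear_combination (72192 - 359424 * k - 2815744 * k ^ 2 - 3339904 * k ^ 3 + 7744800 * k ^ 4
        + 18674240 * k ^ 5 - 3460512 * k ^ 6 - 35450176 * k ^ 7 - 8020864 * k ^ 8 + 37201408 * k ^ 9
        + 10886784 * k ^ 10 - 23696384 * k ^ 11 - 4746240 * k ^ 12 + 7849984 * k ^ 13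
        + 370688 * k ^ 14 - 786432 * k ^ 15) * hk
    exact (mul_eq_zero.1 h5).resolve_right (by positivity)
  have hder : C * (1 + 4 * k + 6 * k ^ 2 - 16 * k ^ 3) = 3 - 12 * k - 18 * k ^ 2 + 16 * k ^ 3 := by
    apply mul_left_cancel₀ hden.ne'
    linear_combination (1 + 4 * k + 6 * k ^ 2 - 16 * k ^ 3) * hC + 4 * (1 + k) * hk
  refine ⟨C, ?_, ?_, natDegree_minpoly_quintic hroot, by linarith, ⟨k, hk0, by linarith, hC.symm⟩, ?_⟩
  · ext x
    simp only [Set.mem_ofPred_eq, Set.mem_singleton_iff]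
    constructor
    · rintro ⟨hx, hxr⟩
      rcases lt_trichotomy x C with h | h | h
      · have := quintic_mul_sq_lt hx h
        rw [hxr, hroot] at this
        simp at this
      · exact h
      · have := quintic_mul_sq_lt (by linarith) h
        rw [hxr, hroot] at this
        simp at this
    · rintro rfl
      exact ⟨by linarith, hroot⟩
  · rw [abs_lt]
    constructor
    · by_contra! h
      have h' : C < 1.053322135 - 1 / 10 ^ 9 * (1 / 2) := by linarith
      have := quintic_mul_sq_lt (by linarith) h'
      rw [hroot, zero_mul] at this
      have := pos_of_mul_pos_left this (by positivity)
      norm_num at this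
    · by_contra! h
      have h' : 1.053322135 + 1 / 10 ^ 9 * (1 - 1 / 20) < C := by linarith
      have := quintic_mul_sq_lt (by norm_num) h'
      rw [hroot, zero_mul] at this
      have := neg_of_mul_neg_left this (by positivity)
      norm_num at this
  · intro m hm0 hm1
    have hm2 : 0 < 2 - m := by linarith
    rw [← abs_of_pos hm2, ← abs_mul, abs_le]
    constructor
    · have h1 := mul_nonneg (sub_nonneg.2 hC1.le) (hpos m hm0 hm1).le
      have h2 : 0 ≤ (1 + m) ^ 2 * (1 - m) := mul_nonneg (by positivity) (by linarith)
      linarith [show (2 * m + 1) * (1 - 2 * m ^ 2) * (2 - m) + (1 + 2 * m ^ 2) * (2 + m - 2 * m ^ 2)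
        = 4 * ((1 + m) ^ 2 * (1 - m)) by ring]
    -- Splitting off the double root `k` leaves a concave quadratic with coefficients `β`, `γ`. It
    -- is nonnegative on `[0, 1]` because it is positive at both endpoints, as evaluating `e` there
    -- shows.
    · obtain ⟨β, hβ⟩ : ∃ β, β = 2 * C + 6 - 2 * k * (4 * C + 4) := ⟨_, rfl⟩
      obtain ⟨γ, hγ⟩ : ∃ γ, γ = 2 * C + 6 + 2 * k * β + k ^ 2 * (4 * C + 4) := ⟨_, rfl⟩
      have e : ∀ m, C * ((1 + 2 * m ^ 2) * (2 + m - 2 * m ^ 2)) - (2 * m + 1) * (1 - 2 * m ^ 2) * (2 - m)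
          = (m - k) ^ 2 * (-(4 * C + 4) * m ^ 2 + β * m + γ) := by
        intro m
        rw [hγ, hβ]
        linear_combination hC + (m - k) * hder
      have h0 : 0 < γ := by
        have := e 0
        have h : 0 < k ^ 2 * γ := by linarith
        exact pos_of_mul_pos_right h (by positivity)
      have h1 : 0 < -(4 * C + 4) + β + γ := by
        have := e 1
        have h : 0 < (1 - k) ^ 2 * (-(4 * C + 4) + β + γ) := by linarith
        exact pos_of_mul_pos_right h (by positivity)
      have hQ : 0 ≤ -(4 * C + 4) * m ^ 2 + β * m + γ := by
        have hm1' : 0 < 1 - m := by linarith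
        have : -(4 * C + 4) * m ^ 2 + β * m + γ = (1 - m) * γ + m * (-(4 * C + 4) + β + γ)
          + (4 * C + 4) * (m * (1 - m)) := by ring
        rw [this]
        positivity
      have := mul_nonneg (sq_nonneg (m - k)) hQ
      linarith [e m]

/-! ### Distances in terms of inradius, circumradius and semiperimeter -/

namespace TriangleCenters

/-- The square of the distance from `X_5` to `X_n`, in units of the circumradius, in terms of
`ρ = r / R` and `σ = (s / R) ^ 2`, where `r` is the inradius and `s` the semiperimeter. -/
noncomputable def sqDist (n : ℕ) (ρ σ : ℝ) : ℝ :=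
  match n with
  | 1 => (1 / 2 - ρ) ^ 2
  | 2 => (9 - 2 * (σ - ρ ^ 2 - 4 * ρ)) / 36
  | 3 => (9 - 2 * (σ - ρ ^ 2 - 4 * ρ)) / 4
  | 4 => (9 - 2 * (σ - ρ ^ 2 - 4 * ρ)) / 4
  | 6 => 1 / 4 + 2 * ρ ^ 2 * σ * (σ - ρ ^ 2 - 4 * ρ - 6) / (σ - ρ ^ 2 - 4 * ρ) ^ 2
  | 7 => 1 / 4 + (σ - ρ ^ 2 - 4 * ρ) / 2 - 4 * ρ * σ * (1 + ρ) / (4 + ρ) ^ 2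
      - 2 * σ * (1 - ρ) / (4 + ρ)
  | 8 => 2 * (1 - 2 * ρ) + 2 * (1 / 2 - ρ) ^ 2 - (9 - 2 * (σ - ρ ^ 2 - 4 * ρ)) / 4
  | 9 => (1 - 4 * ρ * σ * (1 + ρ) / (4 + ρ) ^ 2) / 4
  | 10 => (1 - 2 * ρ) / 4
  | _ => 0

/-- For the isosceles triangle whose half apex angle has sine `m`, the distance from `X_5` to `X_n`
is `|(2 * m - 1) / 2 * axisCoord n m|`, in units of the circumradius. -/
noncomputable def axisCoord (n : ℕ) (m : ℝ) : ℝ :=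
  match n with
  | 1 => 2 * m - 1
  | 2 => (2 * m + 1) / 3
  | 3 => 2 * m + 1
  | 4 => 2 * m + 1
  | 6 => (2 * m + 1) * (1 - 2 * m ^ 2) / (1 + 2 * m ^ 2)
  | 7 => (2 - m - 2 * m ^ 2) / (2 - m)
  | 8 => 3 - 2 * m
  | 9 => (2 + m - 2 * m ^ 2) / (2 - m)
  | 10 => 1
  | _ => 0

/-- The indices of the centers under consideration, other than the nine-point center itself. -/
def centerIndices : Finset ℕ := {1, 2, 3, 4, 6, 7, 8, 9, 10}

/-- The value of `(s / R) ^ 2` for an isosceles triangle. -/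
def isoSigma (m : ℝ) : ℝ := 4 * (1 - m) * (1 + m) ^ 3

/-- The expression becomes a perfect square because the centers are collinear on the axis of
symmetry; the common factor `2 * m - 1` reflects that they all coincide in the equilateral triangle.
-/
lemma sqDist_isosceles {n : ℕ} (hn : n ∈ centerIndices) {m : ℝ} (h0 : 0 < m) (h1 : m < 1) :
    sqDist n (2 * m * (1 - m)) (isoSigma m) = ((2 * m - 1) / 2 * axisCoord n m) ^ 2 := by
  have h2 : 2 - m ≠ 0 := by linarith
  have h3 : 1 + 2 * m ^ 2 ≠ 0 := by positivity
  have h1' : 1 - m ≠ 0 := by linarith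
  have h1'' : 1 + m ≠ 0 := by linarith
  have h4 : 4 + 2 * m * (1 - m) = 2 * (2 - m) * (1 + m) := by ring
  have h5 : 4 * (1 - m) * (1 + m) ^ 3 - (2 * m * (1 - m)) ^ 2 - 4 * (2 * m * (1 - m))
      = 4 * (1 - m) * (1 + m) * (1 + 2 * m ^ 2) := by ring
  simp only [centerIndices, Finset.mem_insert, Finset.mem_singleton] at hn
  rcases hn with rfl | rfl | rfl | rfl | rfl | rfl | rfl | rfl | rfl <;>
    simp only [sqDist, axisCoord, isoSigma, h4, h5] <;> field_simp <;> ring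

/-- The square of the distance between two points given by barycentric coordinates. -/
lemma dist_ofBarycentric_sq (T : Affine.Triangle ℝ Plane) {u v w u' v' w' : ℝ}
    (h : u + v + w ≠ 0) (h' : u' + v' + w' ≠ 0) :
    dist (ofBarycentric T u v w) (ofBarycentric T u' v' w') ^ 2 =
      -(dist (T.points 1) (T.points 2) ^ 2 * (v / (u + v + w) - v' / (u' + v' + w'))
          * (w / (u + v + w) - w' / (u' + v' + w'))
        + dist (T.points 2) (T.points 0) ^ 2 * (w / (u + v + w) - w' / (u' + v' + w'))
          * (u / (u + v + w) - u' / (u' + v' + w'))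
        + dist (T.points 0) (T.points 1) ^ 2 * (u / (u + v + w) - u' / (u' + v' + w'))
          * (v / (u + v + w) - v' / (u' + v' + w'))) := by
  simp only [ofBarycentric, EuclideanSpace.dist_eq, Fin.sum_univ_two, Real.dist_eq, sq_abs,
    PiLp.add_apply, PiLp.smul_apply, smul_eq_mul]
  rw [Real.sq_sqrt (by positivity), Real.sq_sqrt (by positivity), Real.sq_sqrt (by positivity),
    Real.sq_sqrt (by positivity)]
  obtain ⟨p, hp⟩ : ∃ p, p = u / (u + v + w) - u' / (u' + v' + w') := ⟨_, rfl⟩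
  obtain ⟨q, hq⟩ : ∃ q, q = v / (u + v + w) - v' / (u' + v' + w') := ⟨_, rfl⟩
  obtain ⟨t, ht⟩ : ∃ t, t = w / (u + v + w) - w' / (u' + v' + w') := ⟨_, rfl⟩
  have hsum : t = -p - q := by
    rw [hp, hq, ht]
    field_simp
    ring
  have key : ∀ x y z : ℝ, (u + v + w)⁻¹ * (u * x + v * y + w * z)
      - (u' + v' + w')⁻¹ * (u' * x + v' * y + w' * z) = p * x + q * y + t * z := by
    intro x y z
    rw [hp, hq, ht]
    ring
  rw [key, key, ← hp, ← hq, ← ht, hsum]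
  ring

/-- The square of the distance from the nine-point center to the point with normalized barycentric
coordinates `p`, `q`, `t`; here `A`, `B`, `C` are the squares of the sides. -/
lemma ninePoint_quadratic_form {A B C S p q t : ℝ} (hS : S = 2 * (A * B + B * C + C * A) - A ^ 2 - B ^ 2 - C ^ 2)
    (hS0 : S ≠ 0) (ht : p + q + t = 1) :
    -(A * ((2 * C * A - C ^ 2 - A ^ 2 + B * (C + A)) / (2 * S) - q)
        * ((2 * A * B - A ^ 2 - B ^ 2 + C * (A + B)) / (2 * S) - t)
      + B * ((2 * A * B - A ^ 2 - B ^ 2 + C * (A + B)) / (2 * S) - t)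
        * ((2 * B * C - B ^ 2 - C ^ 2 + A * (B + C)) / (2 * S) - p)
      + C * ((2 * B * C - B ^ 2 - C ^ 2 + A * (B + C)) / (2 * S) - p)
        * ((2 * C * A - C ^ 2 - A ^ 2 + B * (C + A)) / (2 * S) - q)) =
      A * B * C / (4 * S) - (A + B + C) / 4 + (p * (B + C) + q * (C + A) + t * (A + B)) / 2
        - (A * q * t + B * t * p + C * p * q) := by
  obtain rfl : t = 1 - p - q := by linarith
  field_simp
  rw [hS]
  ring

/-- Under the substitution `a = y + z`, `b = z + x`, `c = x + y` the quadratic form depends on the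
center only through `τ`, `N₁`, `N₂`, which each center supplies in terms of the elementary symmetric
functions of `x`, `y`, `z`. The first summand is a quarter of the squared circumradius. -/
lemma D_five_sq_eq (T : Affine.Triangle ℝ Plane) {n : ℕ} {x y z τ N₁ N₂ : ℝ} (hx : 0 < x) (hy : 0 < y)
    (hz : 0 < z) (ha : dist (T.points 1) (T.points 2) = y + z)
    (hb : dist (T.points 2) (T.points 0) = z + x) (hc : dist (T.points 0) (T.points 1) = x + y)
    (hτ : firstCoord n (y + z) (z + x) (x + y) + firstCoord n (z + x) (x + y) (y + z)
      + firstCoord n (x + y) (y + z) (z + x) = τ)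
    (h₁ : firstCoord n (y + z) (z + x) (x + y) * ((z + x) ^ 2 + (x + y) ^ 2)
      + firstCoord n (z + x) (x + y) (y + z) * ((x + y) ^ 2 + (y + z) ^ 2)
      + firstCoord n (x + y) (y + z) (z + x) * ((y + z) ^ 2 + (z + x) ^ 2) = N₁)
    (h₂ : (y + z) ^ 2 * firstCoord n (z + x) (x + y) (y + z) * firstCoord n (x + y) (y + z) (z + x)
      + (z + x) ^ 2 * firstCoord n (x + y) (y + z) (z + x) * firstCoord n (y + z) (z + x) (x + y)
      + (x + y) ^ 2 * firstCoord n (y + z) (z + x) (x + y) * firstCoord n (z + x) (x + y) (y + z) = N₂)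
    (hτ0 : τ ≠ 0) :
    D T 5 n ^ 2 = ((x + y + z) * (x * y + y * z + z * x) - x * y * z) ^ 2
        / (64 * ((x + y + z) * (x * y * z)))
      - ((x + y + z) ^ 2 - (x * y + y * z + z * x)) / 2 + N₁ / (2 * τ) - N₂ / τ ^ 2 := by
  obtain ⟨S, hS⟩ : ∃ S, S = 16 * ((x + y + z) * (x * y * z)) := ⟨_, rfl⟩
  have hS0 : S ≠ 0 := by rw [hS]; positivity
  have hsum : firstCoord 5 (y + z) (z + x) (x + y) + firstCoord 5 (z + x) (x + y) (y + z)
      + firstCoord 5 (x + y) (y + z) (z + x) = -2 * S := by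
    rw [hS]; simp only [firstCoord]; ring
  have hQ := ninePoint_quadratic_form (A := (y + z) ^ 2) (B := (z + x) ^ 2) (C := (x + y) ^ 2) (S := S)
    (p := firstCoord n (y + z) (z + x) (x + y) / τ) (q := firstCoord n (z + x) (x + y) (y + z) / τ)
    (t := firstCoord n (x + y) (y + z) (z + x) / τ) (by rw [hS]; ring) hS0
    (by rw [← add_div, ← add_div, hτ, div_self hτ0])
  have h5 : ∀ a b c : ℝ, firstCoord 5 a b c / (-2 * S)
      = (2 * b ^ 2 * c ^ 2 - (b ^ 2) ^ 2 - (c ^ 2) ^ 2 + a ^ 2 * (b ^ 2 + c ^ 2)) / (2 * S) := by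
    intro a b c
    simp only [firstCoord]
    field_simp
    ring
  rw [D, center, center, dist_ofBarycentric_sq]
  · simp only [ha, hb, hc]
    rw [hsum, hτ, h5, h5, h5, hQ, ← h₁, ← h₂, hS]
    field_simp
    ring
  · simp only [ha, hb, hc]
    rw [hsum]
    simpa using hS0
  · simp only [ha, hb, hc]
    rwa [hτ]

/-- The distances from the nine-point center in terms of the circumradius `R` and of `ρ` and `σ`,
where `x`, `y`, `z` are the lengths of the tangents from the vertices to the incircle. -/
lemma D_five_sq_eq_sqDist (T : Affine.Triangle ℝ Plane) {n : ℕ} (hn : n ∈ centerIndices)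
    {x y z R ρ σ : ℝ} (hx : 0 < x) (hy : 0 < y)
    (hz : 0 < z) (ha : dist (T.points 1) (T.points 2) = y + z)
    (hb : dist (T.points 2) (T.points 0) = z + x) (hc : dist (T.points 0) (T.points 1) = x + y)
    (hR : 0 < R) (hρ : 0 < ρ) (hp : (x + y + z) ^ 2 = R ^ 2 * σ)
    (hq : x * y + y * z + z * x = R ^ 2 * (ρ ^ 2 + 4 * ρ))
    (hr : x * y * z = R ^ 2 * ρ ^ 2 * (x + y + z)) :
    D T 5 n ^ 2 = R ^ 2 * sqDist n ρ σ := by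
  have hs : 0 < x + y + z := by positivity
  have hσ : σ = (x + y + z) ^ 2 / R ^ 2 := by rw [hp]; field_simp
  have hω : 0 < (x + y + z) ^ 2 - (x * y + y * z + z * x) := by nlinarith [mul_pos hx hy, mul_pos hy hz, mul_pos hz hx]
  have hω' : (x + y + z) ^ 2 - R ^ 2 * (ρ ^ 2 + 4 * ρ) ≠ 0 := by rw [← hq]; exact hω.ne'
  have hωd : σ - ρ ^ 2 - 4 * ρ = ((x + y + z) ^ 2 - R ^ 2 * (ρ ^ 2 + 4 * ρ)) / R ^ 2 := by
    rw [hσ]; field_simp; ring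
  have h4 : 4 + ρ ≠ 0 := by positivity
  have hq0 : ρ ^ 2 + 4 * ρ = ρ * (4 + ρ) := by ring
  simp only [centerIndices, Finset.mem_insert, Finset.mem_singleton] at hn
  rcases hn with rfl | rfl | rfl | rfl | rfl | rfl | rfl | rfl | rfl
  · rw [D_five_sq_eq T hx hy hz ha hb hc (τ := 2 * (x + y + z))
      (N₁ := 2 * (x + y + z) ^ 3 - (x + y + z) * (x * y + y * z + z * x) + 3 * (x * y * z))
      (N₂ := 2 * (x + y + z) ^ 2 * (x * y + y * z + z * x) - 2 * (x + y + z) * (x * y * z))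
      (by simp only [firstCoord]; ring) (by simp only [firstCoord]; ring)
      (by simp only [firstCoord]; ring) (by positivity)]
    simp only [sqDist]
    rw [hr, hq]
    generalize x + y + z = s at *
    rw [hq0] at *
    field_simp
    ring
  · rw [D_five_sq_eq T hx hy hz ha hb hc (τ := 3)
      (N₁ := 4 * (x + y + z) ^ 2 - 4 * (x * y + y * z + z * x))
      (N₂ := 2 * (x + y + z) ^ 2 - 2 * (x * y + y * z + z * x))
      (by simp only [firstCoord]; ring) (by simp only [firstCoord]; ring)
      (by simp only [firstCoord]; ring) (by positivity)]
    simp only [sqDist, hωd]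
    rw [hr, hq]
    generalize x + y + z = s at *
    rw [hq0] at *
    field_simp
    ring
  · rw [D_five_sq_eq T hx hy hz ha hb hc (τ := -(16 * (x + y + z) * (x * y * z)))
      (N₁ := -6 * (x + y + z) ^ 2 * (x * y + y * z + z * x) ^ 2 + 12 * (x + y + z) * (x * y + y * z + z * x) * (x * y * z) - 6 * (x * y * z) ^ 2)
      (N₂ := 16 * (x + y + z) ^ 3 * (x * y + y * z + z * x) ^ 2 * (x * y * z) - 32 * (x + y + z) ^ 2 * (x * y + y * z + z * x) * (x * y * z) ^ 2 + 16 * (x + y + z) * (x * y * z) ^ 3)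
      (by simp only [firstCoord]; ring) (by simp only [firstCoord]; ring)
      (by simp only [firstCoord]; ring) (by rw [neg_ne_zero]; positivity)]
    simp only [sqDist, hωd]
    rw [hr, hq]
    generalize x + y + z = s at *
    rw [hq0] at *
    field_simp
    ring
  · rw [D_five_sq_eq T hx hy hz ha hb hc (τ := 16 * (x + y + z) * (x * y * z))
      (N₁ := -12 * (x + y + z) ^ 2 * (x * y + y * z + z * x) ^ 2 + 64 * (x + y + z) ^ 3 * (x * y * z) - 40 * (x + y + z) * (x * y + y * z + z * x) * (x * y * z) - 12 * (x * y * z) ^ 2)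
      (N₂ := -128 * (x + y + z) ^ 3 * (x * y + y * z + z * x) ^ 2 * (x * y * z) + 512 * (x + y + z) ^ 4 * (x * y * z) ^ 2 - 256 * (x + y + z) ^ 2 * (x * y + y * z + z * x) * (x * y * z) ^ 2 - 128 * (x + y + z) * (x * y * z) ^ 3)
      (by simp only [firstCoord]; ring) (by simp only [firstCoord]; ring)
      (by simp only [firstCoord]; ring) (by positivity)]
    simp only [sqDist, hωd]
    rw [hr, hq]
    generalize x + y + z = s at *
    rw [hq0] at *
    field_simp
    ring
  · rw [D_five_sq_eq T hx hy hz ha hb hc (τ := 2 * ((x + y + z) ^ 2 - (x * y + y * z + z * x)))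
      (N₁ := 2 * (x + y + z) ^ 4 - 4 * (x + y + z) ^ 2 * (x * y + y * z + z * x) + 2 * (x * y + y * z + z * x) ^ 2 + 8 * (x + y + z) * (x * y * z))
      (N₂ := 3 * (x + y + z) ^ 2 * (x * y + y * z + z * x) ^ 2 - 6 * (x + y + z) * (x * y + y * z + z * x) * (x * y * z) + 3 * (x * y * z) ^ 2)
      (by simp only [firstCoord]; ring) (by simp only [firstCoord]; ring)
      (by simp only [firstCoord]; ring) (by intro h; linarith)]
    simp only [sqDist, hωd]
    rw [hr, hq, hσ]
    generalize x + y + z = s at *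
    rw [hq0] at *
    obtain ⟨ω, hω⟩ : ∃ ω, ω = s ^ 2 - R ^ 2 * (ρ * (4 + ρ)) := ⟨_, rfl⟩
    rw [← hω] at hω' ⊢
    field_simp
    rw [hω]
    ring
  · rw [D_five_sq_eq T hx hy hz ha hb hc (τ := 4 * (x * y + y * z + z * x))
      (N₁ := 4 * (x + y + z) ^ 2 * (x * y + y * z + z * x) - 8 * (x * y + y * z + z * x) ^ 2 + 20 * (x + y + z) * (x * y * z))
      (N₂ := 16 * (x + y + z) * (x * y + y * z + z * x) * (x * y * z) + 48 * (x * y * z) ^ 2)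
      (by simp only [firstCoord]; ring) (by simp only [firstCoord]; ring)
      (by simp only [firstCoord]; ring) (by positivity)]
    simp only [sqDist, hωd]
    rw [hr, hq, hσ]
    generalize x + y + z = s at *
    rw [hq0] at *
    field_simp
    ring
  · rw [D_five_sq_eq T hx hy hz ha hb hc (τ := -(2 * (x + y + z)))
      (N₁ := -4 * (x + y + z) ^ 3 + 6 * (x + y + z) * (x * y + y * z + z * x) + 6 * (x * y * z))
      (N₂ := 4 * (x + y + z) ^ 2 * (x * y + y * z + z * x) - 20 * (x + y + z) * (x * y * z))
      (by simp only [firstCoord]; ring) (by simp only [firstCoord]; ring)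
      (by simp only [firstCoord]; ring) (by rw [neg_ne_zero]; positivity)]
    simp only [sqDist, hωd]
    rw [hr, hq]
    generalize x + y + z = s at *
    rw [hq0] at *
    field_simp
    ring
  · rw [D_five_sq_eq T hx hy hz ha hb hc (τ := -(4 * (x * y + y * z + z * x)))
      (N₁ := -6 * (x + y + z) ^ 2 * (x * y + y * z + z * x) + 4 * (x * y + y * z + z * x) ^ 2 + 10 * (x + y + z) * (x * y * z))
      (N₂ := 4 * (x + y + z) ^ 2 * (x * y + y * z + z * x) ^ 2 - 16 * (x + y + z) * (x * y + y * z + z * x) * (x * y * z) + 12 * (x * y * z) ^ 2)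
      (by simp only [firstCoord]; ring) (by simp only [firstCoord]; ring)
      (by simp only [firstCoord]; ring) (by rw [neg_ne_zero]; positivity)]
    simp only [sqDist]
    rw [hr, hq, hσ]
    generalize x + y + z = s at *
    rw [hq0] at *
    field_simp
    ring
  · rw [D_five_sq_eq T hx hy hz ha hb hc (τ := 4 * (x + y + z))
      (N₁ := 6 * (x + y + z) ^ 3 - 7 * (x + y + z) * (x * y + y * z + z * x) - 3 * (x * y * z))
      (N₂ := 4 * (x + y + z) ^ 4 - 4 * (x + y + z) ^ 2 * (x * y + y * z + z * x) - 8 * (x + y + z) * (x * y * z))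
      (by simp only [firstCoord]; ring) (by simp only [firstCoord]; ring)
      (by simp only [firstCoord]; ring) (by positivity)]
    simp only [sqDist]
    rw [hr, hq]
    generalize x + y + z = s at *
    rw [hq0] at *
    field_simp
    ring

/-! ### The fundamental inequality and isosceles triangles -/

lemma D_nonneg (T : Affine.Triangle ℝ Plane) (i j : ℕ) : 0 ≤ D T i j :=
  dist_nonneg

lemma dist_points_lt (T : Affine.Triangle ℝ Plane) {i j k : Fin 3} (hij : i ≠ j) (hik : i ≠ k)
    (hjk : j ≠ k) :
    dist (T.points i) (T.points k) < dist (T.points i) (T.points j) + dist (T.points j) (T.points k) := by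
  rw [dist_lt_dist_add_dist_iff]
  intro h
  have hc := h.collinear
  have hI := T.independent
  rw [affineIndependent_iff_not_collinear_of_ne hij hik hjk] at hI
  exact hI hc

/-- With `s = x + y + z`, Heron's formula gives `r ^ 2 = x * y * z / s`, and `R = a * b * c / (4 * r
* s)`. The second identity is then `x * y + y * z + z * x = r ^ 2 + 4 * R * r`. -/
lemma exists_circumradius_inradius {x y z : ℝ} (hx : 0 < x) (hy : 0 < y) (hz : 0 < z) :
    ∃ R ρ σ : ℝ, 0 < R ∧ 0 < ρ ∧ (x + y + z) ^ 2 = R ^ 2 * σ ∧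
      x * y + y * z + z * x = R ^ 2 * (ρ ^ 2 + 4 * ρ) ∧ x * y * z = R ^ 2 * ρ ^ 2 * (x + y + z) := by
  have hp : 0 < x + y + z := by positivity
  set r := √(x * y * z / (x + y + z)) with hr
  have hr0 : 0 < r := Real.sqrt_pos.2 (by positivity)
  have hr2 : r ^ 2 * (x + y + z) = x * y * z := by
    rw [hr, Real.sq_sqrt (by positivity)]
    field_simp
  have habc : 0 < (x + y) * (y + z) * (z + x) := by positivity
  have hR : 0 < (x + y) * (y + z) * (z + x) / (4 * r * (x + y + z)) := by positivity
  obtain ⟨R, hRe⟩ : ∃ R, R = (x + y) * (y + z) * (z + x) / (4 * r * (x + y + z)) := ⟨_, rfl⟩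
  rw [← hRe] at hR
  have h4 : 4 * R * r * (x + y + z) = (x + y) * (y + z) * (z + x) := by
    rw [hRe]
    field_simp
  refine ⟨R, r / R, (x + y + z) ^ 2 / R ^ 2, hR, by positivity, by field_simp, ?_, ?_⟩
  · have e : R ^ 2 * ((r / R) ^ 2 + 4 * (r / R)) = r ^ 2 + 4 * R * r := by field_simp
    rw [e]
    apply mul_right_cancel₀ hp.ne'
    linear_combination -hr2 - h4
  · rw [← hr2]
    field_simp

/-- The fundamental inequality of a triangle. -/
lemma fundamental_inequality {x y z R ρ σ : ℝ} (hR : 0 < R) (hρ : 0 < ρ)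
    (hp : (x + y + z) ^ 2 = R ^ 2 * σ)
    (hq : x * y + y * z + z * x = R ^ 2 * (ρ ^ 2 + 4 * ρ))
    (hr : x * y * z = R ^ 2 * ρ ^ 2 * (x + y + z)) :
    (σ - 2 - 10 * ρ + ρ ^ 2) ^ 2 ≤ 4 * (1 - 2 * ρ) ^ 3 := by
  -- The inequality is nonnegativity of the discriminant of the cubic with roots `x`, `y`, `z`.
  have e : ((x - y) * (y - z) * (z - x)) ^ 2 =
      (x + y + z) ^ 2 * (x * y + y * z + z * x) ^ 2 - 4 * (x * y + y * z + z * x) ^ 3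
      - 4 * (x + y + z) ^ 3 * (x * y * z) + 18 * (x + y + z) * (x * y + y * z + z * x) * (x * y * z)
      - 27 * (x * y * z) ^ 2 := by ring
  have e2 : ((x - y) * (y - z) * (z - x)) ^ 2
      = R ^ 6 * (4 * ρ ^ 2) * (4 * (1 - 2 * ρ) ^ 3 - (σ - 2 - 10 * ρ + ρ ^ 2) ^ 2) := by
    rw [e, hr, hq]
    have h1 : R ^ 2 * σ * (R ^ 2 * σ) = (x + y + z) ^ 2 * (x + y + z) ^ 2 := by rw [hp]
    generalize x + y + z = s at *
    have : s ^ 3 * (R ^ 2 * ρ ^ 2 * s) = R ^ 2 * ρ ^ 2 * (R ^ 2 * σ) ^ 2 := by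
      rw [← hp]; ring
    linear_combination (R ^ 4 * (ρ ^ 2 + 4 * ρ) ^ 2 + 18 * R ^ 4 * ρ ^ 2 * (ρ ^ 2 + 4 * ρ)
      - 27 * R ^ 4 * ρ ^ 4) * hp - 4 * this
  have h0 : 0 ≤ R ^ 6 * (4 * ρ ^ 2) * (4 * (1 - 2 * ρ) ^ 3 - (σ - 2 - 10 * ρ + ρ ^ 2) ^ 2) :=
    e2 ▸ sq_nonneg _
  linarith [nonneg_of_mul_nonneg_right h0 (by positivity)]

/-- The parameters of a triangle: `m` determines the ratio of the inradius and the circumradius `R`,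
and `σ` is the square of the ratio of the semiperimeter and `R`. -/
lemma exists_params (T : Affine.Triangle ℝ Plane) : ∃ R m σ : ℝ, 0 < R ∧ 1 / 2 ≤ m ∧ m < 1 ∧
    isoSigma m ≤ σ ∧ σ ≤ isoSigma (1 - m) ∧
    ∀ n ∈ centerIndices, D T 5 n ^ 2 = R ^ 2 * sqDist n (2 * m * (1 - m)) σ := by
  obtain ⟨a, ha⟩ : ∃ a, a = dist (T.points 1) (T.points 2) := ⟨_, rfl⟩
  obtain ⟨b, hb⟩ : ∃ b, b = dist (T.points 2) (T.points 0) := ⟨_, rfl⟩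
  obtain ⟨c, hc⟩ : ∃ c, c = dist (T.points 0) (T.points 1) := ⟨_, rfl⟩
  have h1 : a < b + c := by
    have := dist_points_lt T (i := 1) (j := 0) (k := 2) (by decide) (by decide) (by decide)
    rw [dist_comm (T.points 1) (T.points 0), dist_comm (T.points 0) (T.points 2)] at this
    linarith
  have h2 : b < c + a := by
    have := dist_points_lt T (i := 2) (j := 1) (k := 0) (by decide) (by decide) (by decide)
    rw [dist_comm (T.points 2) (T.points 1), dist_comm (T.points 1) (T.points 0)] at this
    linarith
  have h3 : c < a + b := by
    have := dist_points_lt T (i := 0) (j := 2) (k := 1) (by decide) (by decide) (by decide)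
    rw [dist_comm (T.points 0) (T.points 2), dist_comm (T.points 2) (T.points 1)] at this
    linarith
  have hx : 0 < (b + c - a) / 2 := by linarith
  have hy : 0 < (c + a - b) / 2 := by linarith
  have hz : 0 < (a + b - c) / 2 := by linarith
  obtain ⟨R, ρ, σ, hR, hρ, hp, hq, hr⟩ := exists_circumradius_inradius hx hy hz
  have hf := fundamental_inequality hR hρ hp hq hr
  -- Euler's inequality `2 * r ≤ R`, read off from the sign of the right side in the fundamental
  -- inequality.
  have hE : 0 ≤ 1 - 2 * ρ := by
    by_contra! h
    have h' : (1 - 2 * ρ) ^ 3 < 0 := by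
      rw [show (1 - 2 * ρ) ^ 3 = (1 - 2 * ρ) * (1 - 2 * ρ) ^ 2 by ring]
      exact mul_neg_of_neg_of_pos h (sq_pos_iff.2 h.ne)
    linarith [sq_nonneg (σ - 2 - 10 * ρ + ρ ^ 2)]
  -- With `m = (1 + t) / 2`, the bounds `2 + 10 * ρ - ρ ^ 2 ∓ 2 * t ^ 3` on `σ` are exactly
  -- `isoSigma m` and `isoSigma (1 - m)`.
  obtain ⟨t, ht0, ht⟩ : ∃ t : ℝ, 0 ≤ t ∧ t ^ 2 = 1 - 2 * ρ := ⟨√(1 - 2 * ρ), Real.sqrt_nonneg _, Real.sq_sqrt hE⟩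
  have hρt : ρ = (1 - t ^ 2) / 2 := by linarith
  have ht1 : t < 1 := by nlinarith
  have hm : 2 * ((1 + t) / 2) * (1 - (1 + t) / 2) = ρ := by rw [hρt]; ring
  have habs : |σ - 2 - 10 * ρ + ρ ^ 2| ≤ 2 * t ^ 3 := by
    apply abs_le_of_sq_le_sq _ (by positivity)
    rw [← ht] at hf
    linarith [show (2 * t ^ 3) ^ 2 = 4 * (t ^ 2) ^ 3 by ring]
  rw [abs_le, hρt] at habs
  refine ⟨R, (1 + t) / 2, σ, hR, by linarith, by linarith, ?_, ?_, ?_⟩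
  · rw [isoSigma]
    linarith [show 4 * (1 - (1 + t) / 2) * (1 + (1 + t) / 2) ^ 3
      = 2 + 10 * ((1 - t ^ 2) / 2) - ((1 - t ^ 2) / 2) ^ 2 - 2 * t ^ 3 by ring]
  · rw [isoSigma]
    linarith [show 4 * (1 - (1 - (1 + t) / 2)) * (1 + (1 - (1 + t) / 2)) ^ 3
      = 2 + 10 * ((1 - t ^ 2) / 2) - ((1 - t ^ 2) / 2) ^ 2 + 2 * t ^ 3 by ring]
  · intro n hn
    rw [hm]
    exact D_five_sq_eq_sqDist T hn hx hy hz (by linarith) (by linarith) (by linarith) hR hρ hp hq hr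

/-- The isosceles triangles inscribed in the unit circle. -/
lemma exists_isosceles {m : ℝ} (h0 : 0 < m) (h1 : m < 1) : ∃ T : Affine.Triangle ℝ Plane,
    ∀ n ∈ centerIndices, D T 5 n = |2 * m - 1| / 2 * |axisCoord n m| := by
  obtain ⟨k, hk, hk2⟩ : ∃ k : ℝ, 0 < k ∧ k ^ 2 = 1 - m ^ 2 :=
    ⟨√(1 - m ^ 2), Real.sqrt_pos.2 (by nlinarith), Real.sq_sqrt (by nlinarith)⟩
  -- The apex is `(0, 1)`; `m` and `k` are the sine and cosine of half the apex angle, so the base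
  -- has length `4 * m * k` and the legs `2 * k`.
  have hI : AffineIndependent ℝ ![(!₂[0, 1] : Plane), !₂[-(2 * m * k), 2 * m ^ 2 - 1],
      !₂[2 * m * k, 2 * m ^ 2 - 1]] := by
    rw [affineIndependent_iff_not_collinear_set, collinear_iff_of_mem (p₀ := (!₂[0, 1] : Plane)) (by simp)]
    rintro ⟨v, hv⟩
    obtain ⟨r, hr⟩ := hv !₂[-(2 * m * k), 2 * m ^ 2 - 1] (by simp)
    obtain ⟨s, hs⟩ := hv !₂[2 * m * k, 2 * m ^ 2 - 1] (by simp)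
    have hr0 := congrArg (fun p : Plane => p 0) hr
    have hr1 := congrArg (fun p : Plane => p 1) hr
    have hs0 := congrArg (fun p : Plane => p 0) hs
    have hs1 := congrArg (fun p : Plane => p 1) hs
    simp at hr0 hr1 hs0 hs1
    have hmk : 0 < m * k := by positivity
    have hd : 2 * (2 * m * k) * (2 * (m ^ 2 - 1)) = 0 := by
      linear_combination (r * v 1) * hs0 - (s * v 1) * hr0 + (2 * m * k) * hr1 + (2 * m * k) * hs1
    rw [show m ^ 2 - 1 = -k ^ 2 by linarith] at hd
    have : 0 < m * k * k ^ 2 := by positivity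
    linarith
  have dist_eq : ∀ a b c d l : ℝ, 0 ≤ l → (a - c) ^ 2 + (b - d) ^ 2 = l ^ 2 →
      dist (!₂[a, b] : Plane) !₂[c, d] = l := by
    intro a b c d l hl h
    rw [EuclideanSpace.dist_eq, Fin.sum_univ_two]
    simp only [Real.dist_eq, sq_abs]
    simp [h, hl]
  refine ⟨⟨_, hI⟩, fun n hn => ?_⟩
  have h2 := D_five_sq_eq_sqDist ⟨_, hI⟩ hn (x := 2 * k * (1 - m)) (y := 2 * m * k) (z := 2 * m * k)
    (R := 1) (ρ := 2 * m * (1 - m)) (σ := isoSigma m) (mul_pos (by positivity) (by linarith))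
    (by positivity) (by positivity)
    (dist_eq _ _ _ _ _ (by positivity) (by ring))
    (dist_eq _ _ _ _ _ (by nlinarith) (by linear_combination (4 * m ^ 2 - 4) * hk2))
    (dist_eq _ _ _ _ _ (by nlinarith) (by linear_combination (4 * m ^ 2 - 4) * hk2))
    one_pos (mul_pos (by positivity) (by linarith))
    (by rw [isoSigma]; linear_combination 4 * (1 + m) ^ 2 * hk2)
    (by linear_combination (8 * m - 4 * m ^ 2) * hk2)
    (by linear_combination 8 * m ^ 2 * (1 - m) * k * hk2)
  rw [one_pow, one_mul, sqDist_isosceles hn h0 h1] at h2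
  have h3 := (sq_eq_sq_iff_abs_eq_abs _ _).1 h2
  rwa [abs_of_nonneg (D_nonneg _ _ _), abs_mul, abs_div, abs_two] at h3

/-! ### Reduction to isosceles triangles -/

lemma sqDist_eq_affine {n : ℕ} (hn : n ∈ centerIndices) (h6 : n ≠ 6) (ρ σ : ℝ) :
    sqDist n ρ σ = sqDist n ρ 0 + σ * (sqDist n ρ 1 - sqDist n ρ 0) := by
  simp only [centerIndices, Finset.mem_insert, Finset.mem_singleton] at hn
  rcases hn with rfl | rfl | rfl | rfl | rfl | rfl | rfl | rfl | rfl
  on_goal 5 => exact absurd rfl h6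
  all_goals
    simp only [sqDist]
    ring

lemma mul_sqDist_isosceles_le {i j : ℕ} (hi : i ∈ centerIndices) (hj : j ∈ centerIndices)
    {k l m : ℝ} (hk : 0 ≤ k) (h0 : 0 < m) (h1 : m < 1)
    (h : k * |axisCoord i m| ≤ l * |axisCoord j m|) :
    k ^ 2 * sqDist i (2 * m * (1 - m)) (isoSigma m) ≤ l ^ 2 * sqDist j (2 * m * (1 - m)) (isoSigma m) := by
  rw [sqDist_isosceles hi h0 h1, sqDist_isosceles hj h0 h1]
  have h2 := pow_le_pow_left₀ (by positivity) h 2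
  rw [mul_pow, mul_pow, sq_abs, sq_abs] at h2
  have h3 := mul_le_mul_of_nonneg_left h2 (sq_nonneg ((2 * m - 1) / 2))
  linarith

lemma mul_D_le_of_sqDist {i j : ℕ} (hi : i ∈ centerIndices) (hj : j ∈ centerIndices)
    {k l : ℝ} (hl : 0 ≤ l)
    (h : ∀ m σ : ℝ, 1 / 2 ≤ m → m < 1 → isoSigma m ≤ σ → σ ≤ isoSigma (1 - m) →
      k ^ 2 * sqDist i (2 * m * (1 - m)) σ ≤ l ^ 2 * sqDist j (2 * m * (1 - m)) σ)
    (T : Affine.Triangle ℝ Plane) : k * D T 5 i ≤ l * D T 5 j := by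
  obtain ⟨R, m, σ, -, hm, hm1, h1, h2, hD⟩ := exists_params T
  refine le_of_abs_le (abs_le_of_sq_le_sq ?_ (mul_nonneg hl (D_nonneg _ _ _)))
  rw [mul_pow, mul_pow, hD i hi, hD j hj]
  have := mul_le_mul_of_nonneg_left (h m σ hm hm1 h1 h2) (sq_nonneg R)
  linarith

/-- For centers other than the symmedian point it is enough to compare the distances from the
nine-point center in isosceles triangles. -/
lemma mul_D_le_of_axisCoord {i j : ℕ} (hi : i ∈ centerIndices) (hj : j ∈ centerIndices)
    (hi6 : i ≠ 6) (hj6 : j ≠ 6) {k l : ℝ} (hk : 0 ≤ k) (hl : 0 ≤ l)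
    (h : ∀ m : ℝ, 0 < m → m < 1 → k * |axisCoord i m| ≤ l * |axisCoord j m|)
    (T : Affine.Triangle ℝ Plane) : k * D T 5 i ≤ l * D T 5 j := by
  refine mul_D_le_of_sqDist hi hj hl (fun m σ hm hm1 h1 h2 => ?_) T
  have e0 := mul_sqDist_isosceles_le hi hj hk (by linarith) hm1 (h m (by linarith) hm1)
  have e1 := mul_sqDist_isosceles_le hi hj hk (m := 1 - m) (by linarith) (by linarith)
    (h (1 - m) (by linarith) (by linarith))
  rw [show 2 * (1 - m) * (1 - (1 - m)) = 2 * m * (1 - m) by ring] at e1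
  generalize 2 * m * (1 - m) = ρ at *
  rw [sqDist_eq_affine hi hi6 ρ, sqDist_eq_affine hj hj6 ρ] at *
  generalize sqDist i ρ 1 - sqDist i ρ 0 = a at *
  generalize sqDist j ρ 1 - sqDist j ρ 0 = b at *
  -- The difference of the two sides is affine in `σ`; the sign of its slope tells which endpoint
  -- bounds it from below.
  rcases le_total 0 (l ^ 2 * b - k ^ 2 * a) with hs | hs
  · linarith [mul_nonneg (sub_nonneg.2 h1) hs]
  · linarith [mul_nonneg (sub_nonneg.2 h2) (neg_nonneg.2 hs)]

/-- An explicit difference quotient in `σ`: its sign yields monotonicity, and its size is compared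
with the slope for the Nagel point. -/
lemma sqDist_six_sub {ρ σ τ : ℝ} (h₁ : 0 < σ - ρ ^ 2 - 4 * ρ) (h₂ : 0 < τ - ρ ^ 2 - 4 * ρ) :
    sqDist 6 ρ τ - sqDist 6 ρ σ = 2 * ρ ^ 2 * (τ - σ) *
      ((6 - ρ ^ 2 - 4 * ρ) / ((σ - ρ ^ 2 - 4 * ρ) * (τ - ρ ^ 2 - 4 * ρ))
        + 6 * (ρ ^ 2 + 4 * ρ) * ((σ - ρ ^ 2 - 4 * ρ) + (τ - ρ ^ 2 - 4 * ρ))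
          / ((σ - ρ ^ 2 - 4 * ρ) ^ 2 * (τ - ρ ^ 2 - 4 * ρ) ^ 2)) := by
  obtain ⟨u, hu⟩ : ∃ u, u = σ - ρ ^ 2 - 4 * ρ := ⟨_, rfl⟩
  obtain ⟨v, hv⟩ : ∃ v, v = τ - ρ ^ 2 - 4 * ρ := ⟨_, rfl⟩
  simp only [sqDist]
  rw [← hu] at h₁
  rw [← hv] at h₂
  rw [← hu, ← hv, show σ = u + ρ ^ 2 + 4 * ρ by linarith, show τ = v + ρ ^ 2 + 4 * ρ by linarith]
  field_simp
  ring

lemma isoSigma_sub (m : ℝ) : isoSigma m - (2 * m * (1 - m)) ^ 2 - 4 * (2 * m * (1 - m))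
    = 4 * (1 - m) * (1 + m) * (1 + 2 * m ^ 2) := by
  rw [isoSigma]
  ring

lemma isoSigma_sub_pos {m : ℝ} (h0 : 0 < m) (h1 : m < 1) :
    0 < isoSigma m - (2 * m * (1 - m)) ^ 2 - 4 * (2 * m * (1 - m)) := by
  rw [isoSigma_sub]
  have : 0 < 1 - m := by linarith
  positivity

lemma sqDist_six_mono {ρ σ τ : ℝ} (hρ : 0 ≤ ρ) (hρ' : ρ ≤ 1 / 2) (h₁ : 0 < σ - ρ ^ 2 - 4 * ρ)
    (h : σ ≤ τ) : sqDist 6 ρ σ ≤ sqDist 6 ρ τ := by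
  have h₂ : 0 < τ - ρ ^ 2 - 4 * ρ := by linarith
  have hk : 0 ≤ 6 - ρ ^ 2 - 4 * ρ := by nlinarith
  have hτ : 0 ≤ τ - σ := by linarith
  rw [← sub_nonneg, sqDist_six_sub h₁ h₂]
  positivity

/-- Comparison with the symmedian point, for centers whose distance from the nine-point center
decreases with the semiperimeter. -/
lemma mul_D_six_le_of_axisCoord {j : ℕ} (hj : j ∈ ({2, 3, 4, 9, 10} : Finset ℕ)) {k l : ℝ} (hk : 0 ≤ k)
    (hl : 0 ≤ l) (h : ∀ m : ℝ, 0 < m → m < 1 → k * |axisCoord 6 m| ≤ l * |axisCoord j m|)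
    (T : Affine.Triangle ℝ Plane) : k * D T 5 6 ≤ l * D T 5 j := by
  have hj' : j ∈ centerIndices := by
    revert hj
    simp only [centerIndices, Finset.mem_insert, Finset.mem_singleton]
    omega
  refine mul_D_le_of_sqDist (by decide) hj' hl (fun m σ hm hm1 h1 h2 => ?_) T
  have hpos := isoSigma_sub_pos (m := m) (by linarith) hm1
  -- Only the upper endpoint of the range of `σ` is used: moving down from it lowers the left side
  -- and does not lower the right.
  have e1 := mul_sqDist_isosceles_le (by decide) hj' hk (m := 1 - m) (by linarith) (by linarith)
    (h (1 - m) (by linarith) (by linarith))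
  rw [show 2 * (1 - m) * (1 - (1 - m)) = 2 * m * (1 - m) by ring] at e1
  have hρ : 0 ≤ 2 * m * (1 - m) := mul_nonneg (by linarith) (by linarith)
  have hρ' : 2 * m * (1 - m) ≤ 1 / 2 := by linarith [sq_nonneg (2 * m - 1)]
  have e6 := sqDist_six_mono hρ hρ' (by linarith : 0 < σ - (2 * m * (1 - m)) ^ 2 - 4 * (2 * m * (1 - m))) h2
  generalize 2 * m * (1 - m) = ρ at *
  have ej : sqDist j ρ (isoSigma (1 - m)) ≤ sqDist j ρ σ := by
    simp only [Finset.mem_insert, Finset.mem_singleton] at hj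
    rcases hj with rfl | rfl | rfl | rfl | rfl <;> simp only [sqDist]
    · linarith
    · linarith
    · linarith
    · gcongr
    · exact le_rfl
  calc k ^ 2 * sqDist 6 ρ σ ≤ k ^ 2 * sqDist 6 ρ (isoSigma (1 - m)) := by gcongr
    _ ≤ l ^ 2 * sqDist j ρ (isoSigma (1 - m)) := e1
    _ ≤ l ^ 2 * sqDist j ρ σ := by gcongr

/-- Both squared distances increase with `σ`, so monotonicity alone does not suffice. The Nagel one
has slope exactly `1 / 2`; it is enough to compare at the lower endpoint and bound the difference
quotient of the other by `1 / 2`. -/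
lemma D_six_le_D_eight (h : ∀ m : ℝ, 0 < m → m < 1 → 1 * |axisCoord 6 m| ≤ 1 * |axisCoord 8 m|)
    (T : Affine.Triangle ℝ Plane) : 1 * D T 5 6 ≤ 1 * D T 5 8 := by
  refine mul_D_le_of_sqDist (by decide) (by decide) zero_le_one (fun m σ hm hm1 h1 _ => ?_) T
  have hm0 : 0 < 1 - m := by linarith
  have hpos := isoSigma_sub_pos (m := m) (by linarith) hm1
  have e0 := mul_sqDist_isosceles_le (i := 6) (j := 8) (by decide) (by decide) zero_le_one
    (by linarith) hm1 (h m (by linarith) hm1)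
  obtain ⟨ρ, hρ⟩ : ∃ ρ, ρ = 2 * m * (1 - m) := ⟨_, rfl⟩
  obtain ⟨u, hu⟩ : ∃ u, u = isoSigma m - ρ ^ 2 - 4 * ρ := ⟨_, rfl⟩
  obtain ⟨v, hv⟩ : ∃ v, v = σ - ρ ^ 2 - 4 * ρ := ⟨_, rfl⟩
  have hρ0 : 0 ≤ ρ := by rw [hρ]; exact mul_nonneg (by linarith) (by linarith)
  have hρ' : ρ ≤ 1 / 2 := by rw [hρ]; linarith [sq_nonneg (2 * m - 1)]
  rw [← hρ] at hpos e0 ⊢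
  rw [← hu] at hpos
  have huv : u ≤ v := by linarith
  have hv0 : 0 < v := by linarith
  have e6 := sqDist_six_sub (ρ := ρ) (σ := isoSigma m) (τ := σ) (by linarith) (by linarith)
  rw [← hu, ← hv] at e6
  have e8 : sqDist 8 ρ σ - sqDist 8 ρ (isoSigma m) = (σ - isoSigma m) / 2 := by
    simp only [sqDist]
    ring
  have hk : 0 ≤ 6 - ρ ^ 2 - 4 * ρ := by nlinarith
  -- The difference quotient decreases in `v`, so its worst case is `v = u`.
  have b1 : (6 - ρ ^ 2 - 4 * ρ) / (u * v) ≤ (6 - ρ ^ 2 - 4 * ρ) / (u * u) := by gcongr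
  have b2 : 6 * (ρ ^ 2 + 4 * ρ) * (u + v) / (u ^ 2 * v ^ 2) ≤ 12 * (ρ ^ 2 + 4 * ρ) / u ^ 3 := by
    have e : 6 * (ρ ^ 2 + 4 * ρ) * (u + v) / (u ^ 2 * v ^ 2)
        = 6 * (ρ ^ 2 + 4 * ρ) / (u * v ^ 2) + 6 * (ρ ^ 2 + 4 * ρ) / (u ^ 2 * v) := by
      field_simp
    have e' : 12 * (ρ ^ 2 + 4 * ρ) / u ^ 3
        = 6 * (ρ ^ 2 + 4 * ρ) / (u * u ^ 2) + 6 * (ρ ^ 2 + 4 * ρ) / (u ^ 2 * u) := by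
      field_simp
      ring
    rw [e, e']
    gcongr
  -- Substituting `u = (1 - m) * w` and `ρ = 2 * m * (1 - m)` lets `(1 - m) ^ 3` factor out; the
  -- crude bound `16 * m ≤ w` then suffices.
  have key : 4 * ρ ^ 2 * ((6 - ρ ^ 2 - 4 * ρ) * u + 12 * (ρ ^ 2 + 4 * ρ)) ≤ u ^ 3 := by
    obtain ⟨w, hw⟩ : ∃ w, w = 4 * (1 + m) * (1 + 2 * m ^ 2) := ⟨_, rfl⟩
    have huw : u = (1 - m) * w := by rw [hu, hρ, isoSigma_sub, hw]; ring
    have hwm : 16 * m ≤ w := by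
      rw [hw]
      nlinarith [mul_nonneg (by linarith : 0 ≤ m - 1 / 2) (by linarith : 0 ≤ m - 1 / 2),
        mul_nonneg (by linarith : 0 ≤ m) (mul_nonneg (by linarith : 0 ≤ m - 1 / 2) (by linarith : 0 ≤ m - 1 / 2))]
    have hw0 : 0 < w := by linarith
    have hmm : 0 < m := by linarith
    calc 4 * ρ ^ 2 * ((6 - ρ ^ 2 - 4 * ρ) * u + 12 * (ρ ^ 2 + 4 * ρ))
        ≤ 4 * ρ ^ 2 * (6 * u + 12 * (9 / 2 * ρ)) := by
          gcongr
          · nlinarith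
          · nlinarith
      _ = (1 - m) ^ 3 * (96 * m ^ 2 * w + 1728 * m ^ 3) := by rw [huw, hρ]; ring
      _ ≤ (1 - m) ^ 3 * w ^ 3 := by
          gcongr
          have q1 : (16 * m) ^ 2 ≤ w ^ 2 := by gcongr
          have q2 := mul_le_mul_of_nonneg_right q1 hw0.le
          have q3 := mul_le_mul_of_nonneg_left hwm (by positivity : 0 ≤ m ^ 2)
          have q4 : 0 < m ^ 3 := by positivity
          linarith
      _ = u ^ 3 := by rw [huw]; ring
  have b3 : 2 * ρ ^ 2 * ((6 - ρ ^ 2 - 4 * ρ) / (u * u) + 12 * (ρ ^ 2 + 4 * ρ) / u ^ 3) ≤ 1 / 2 := by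
    have e : 2 * ρ ^ 2 * ((6 - ρ ^ 2 - 4 * ρ) / (u * u) + 12 * (ρ ^ 2 + 4 * ρ) / u ^ 3)
        = 4 * ρ ^ 2 * ((6 - ρ ^ 2 - 4 * ρ) * u + 12 * (ρ ^ 2 + 4 * ρ)) / u ^ 3 / 2 := by
      field_simp
      ring
    rw [e]
    have := (div_le_one (by positivity)).2 key
    linarith
  have b4 : 2 * ρ ^ 2 * ((6 - ρ ^ 2 - 4 * ρ) / (u * v) + 6 * (ρ ^ 2 + 4 * ρ) * (u + v) / (u ^ 2 * v ^ 2))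
      ≤ 1 / 2 :=
    (mul_le_mul_of_nonneg_left (add_le_add b1 b2) (by positivity)).trans b3
  have b5 := mul_le_mul_of_nonneg_left b4 (sub_nonneg.2 h1)
  linarith

/-! ### Sharpness along isosceles triangles -/

open Filter Topology

lemma continuousAt_axisCoord (n : ℕ) {a : ℝ} (ha : a < 2) : ContinuousAt (axisCoord n) a := by
  have h2 : 2 - a ≠ 0 := by linarith
  have h3 : 1 + 2 * a ^ 2 ≠ 0 := by positivity
  unfold axisCoord
  split <;> fun_prop (disch := assumption)

lemma abs_div_abs_mem_ratios {i j : ℕ} (hi : i ∈ centerIndices) (hj : j ∈ centerIndices) {m : ℝ}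
    (h0 : 0 < m) (h1 : m < 1) (h : m ≠ 1 / 2) (hm : axisCoord j m ≠ 0) :
    |axisCoord i m| / |axisCoord j m| ∈ ratios 5 i j := by
  obtain ⟨T, hT⟩ := exists_isosceles h0 h1
  have hd : |2 * m - 1| / 2 ≠ 0 := by
    have : 2 * m - 1 ≠ 0 := fun h' => h (by linarith)
    simpa using this
  refine ⟨T, ?_, ?_⟩
  · rw [hT j hj]
    exact mul_ne_zero hd (abs_ne_zero.2 hm)
  · rw [hT i hi, hT j hj, mul_div_mul_left _ _ hd]

/-- No triangle gives this value directly at `a = 0`, `1 / 2` or `1`: the first and last are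
degenerate and the equilateral triangle has zero denominator. Continuity of `axisCoord` supplies it
as a limit. -/
lemma abs_div_abs_mem_closure_ratios {i j : ℕ} (hi : i ∈ centerIndices) (hj : j ∈ centerIndices) {a : ℝ}
    (h0 : 0 ≤ a) (h1 : a ≤ 1) (ha : axisCoord j a ≠ 0) :
    |axisCoord i a| / |axisCoord j a| ∈ closure (ratios 5 i j) := by
  set s : Set ℝ := Set.Ioo 0 (1 / 2) ∪ Set.Ioo (1 / 2) 1 with hs
  have hmem : a ∈ closure s := by
    rw [hs, closure_union, closure_Ioo (by norm_num), closure_Ioo (by norm_num)]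
    rcases le_total a (1 / 2) with h | h
    · exact .inl ⟨h0, h⟩
    · exact .inr ⟨h, h1⟩
  have : (𝓝[s] a).NeBot := mem_closure_iff_nhdsWithin_neBot.1 hmem
  have hci := continuousAt_axisCoord i (by linarith : a < 2)
  have hcj := continuousAt_axisCoord j (by linarith : a < 2)
  have ht : Tendsto (fun m => |axisCoord i m| / |axisCoord j m|) (𝓝[s] a)
      (𝓝 (|axisCoord i a| / |axisCoord j a|)) :=
    (hci.abs.div hcj.abs (abs_ne_zero.2 ha)).tendsto.mono_left nhdsWithin_le_nhds
  refine mem_closure_of_tendsto ht ?_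
  filter_upwards [self_mem_nhdsWithin, nhdsWithin_le_nhds (hcj.eventually_ne ha)] with m hm hm'
  rcases hm with ⟨l, r⟩ | ⟨l, r⟩
  · exact abs_div_abs_mem_ratios hi hj l (by linarith) r.ne hm'
  · exact abs_div_abs_mem_ratios hi hj (by linarith) r l.ne' hm'

lemma bestUpper_of_axisCoord {i j : ℕ} (hi : i ∈ centerIndices) (hj : j ∈ centerIndices) {M : ℝ}
    (hM : ∀ T : Affine.Triangle ℝ Plane, 1 * D T 5 i ≤ M * D T 5 j) {a : ℝ}
    (h0 : 0 ≤ a) (h1 : a ≤ 1) (ha : axisCoord j a ≠ 0) (hMa : |axisCoord i a| = M * |axisCoord j a|) :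
    BestUpper 5 i j M := by
  have hM' : ∀ T : Affine.Triangle ℝ Plane, D T 5 i ≤ M * D T 5 j := fun T => by
    simpa using hM T
  refine ⟨hM', isLUB_of_mem_closure ?_ ?_⟩
  · rintro x ⟨T, hT, rfl⟩
    rw [div_le_iff₀ (lt_of_le_of_ne (D_nonneg _ _ _) hT.symm)]
    exact hM' T
  · have := abs_div_abs_mem_closure_ratios hi hj h0 h1 ha
    rwa [hMa, mul_div_cancel_right₀ _ (abs_ne_zero.2 ha)] at this

lemma bestLower_of_axisCoord {i j : ℕ} (hi : i ∈ centerIndices) (hj : j ∈ centerIndices) {M : ℝ}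
    (hM : ∀ T : Affine.Triangle ℝ Plane, M * D T 5 j ≤ 1 * D T 5 i) {a : ℝ}
    (h0 : 0 ≤ a) (h1 : a ≤ 1) (ha : axisCoord j a ≠ 0) (hMa : |axisCoord i a| = M * |axisCoord j a|) :
    BestLower 5 i j M := by
  have hM' : ∀ T : Affine.Triangle ℝ Plane, M * D T 5 j ≤ D T 5 i := fun T => by
    simpa using hM T
  refine ⟨hM', isGLB_of_mem_closure ?_ ?_⟩
  · rintro x ⟨T, hT, rfl⟩
    rw [le_div_iff₀ (lt_of_le_of_ne (D_nonneg _ _ _) hT.symm)]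
    exact hM' T
  · have := abs_div_abs_mem_closure_ratios hi hj h0 h1 ha
    rwa [hMa, mul_div_cancel_right₀ _ (abs_ne_zero.2 ha)] at this

lemma bestLower_zero_of_axisCoord {i j : ℕ} (hi : i ∈ centerIndices) (hj : j ∈ centerIndices) {a : ℝ}
    (h0 : 0 ≤ a) (h1 : a ≤ 1) (ha : axisCoord j a ≠ 0) (hia : axisCoord i a = 0) :
    BestLower 5 i j 0 :=
  bestLower_of_axisCoord hi hj (fun T => by simpa using D_nonneg T 5 i) h0 h1 ha (by simp [hia])

lemma constRatio_of_axisCoord {i j : ℕ} (hi : i ∈ centerIndices) (hj : j ∈ centerIndices)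
    (hi6 : i ≠ 6) (hj6 : j ≠ 6) {k : ℝ} (hk : 0 ≤ k) (hj0 : axisCoord j (1 / 4) ≠ 0)
    (h : ∀ m : ℝ, 0 < m → m < 1 → |axisCoord i m| = k * |axisCoord j m|) :
    ConstRatio 5 i j k := by
  have hT : ∀ T : Affine.Triangle ℝ Plane, D T 5 i = k * D T 5 j := by
    intro T
    have h1 := mul_D_le_of_axisCoord hi hj hi6 hj6 (k := 1) (l := k) zero_le_one hk
      (fun m h0 h1 => by rw [one_mul, h m h0 h1]) T
    have h2 := mul_D_le_of_axisCoord hj hi hj6 hi6 (k := k) (l := 1) hk zero_le_one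
      (fun m h0 h1 => by rw [one_mul, h m h0 h1]) T
    linarith
  refine ⟨hT, Set.eq_singleton_iff_nonempty_unique_mem.2 ⟨⟨_, abs_div_abs_mem_ratios hi hj (m := 1 / 4)
    (by norm_num) (by norm_num) (by norm_num) hj0⟩, ?_⟩⟩
  rintro x ⟨T, hT0, rfl⟩
  rw [hT T, mul_div_cancel_right₀ _ hT0]

/-- A bound `B` would give `|axisCoord i m| ≤ B * |axisCoord j m|` just to the right of `a`, hence
`axisCoord i a = 0` in the limit. Approaching from the right of `a ≥ 1 / 2` avoids the equilateral
triangle. -/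
lemma noUpper_of_axisCoord {i j : ℕ} (hi : i ∈ centerIndices) (hj : j ∈ centerIndices) {a : ℝ}
    (h0 : 1 / 2 ≤ a) (h1 : a < 1) (hja : axisCoord j a = 0)
    (hja' : ∀ m : ℝ, a < m → m < 1 → axisCoord j m ≠ 0) (hia : axisCoord i a ≠ 0) :
    NoUpper 5 i j := by
  rintro ⟨B, hB⟩
  have hci := (continuousAt_axisCoord i (by linarith : a < 2)).abs.tendsto.mono_left
    (nhdsWithin_le_nhds (s := Set.Ioi a))
  have hcj := ((continuousAt_axisCoord j (by linarith : a < 2)).abs.tendsto.mono_left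
    (nhdsWithin_le_nhds (s := Set.Ioi a))).const_mul B
  have hle := le_of_tendsto_of_tendsto hci hcj (by
    filter_upwards [Ioo_mem_nhdsGT h1] with m hm
    have hne := hja' m hm.1 hm.2
    have := hB (abs_div_abs_mem_ratios hi hj (by linarith [hm.1]) hm.2 (by linarith [hm.1]) hne)
    rwa [div_le_iff₀ (abs_pos.2 hne)] at this)
  rw [hja, abs_zero, mul_zero] at hle
  exact hia (abs_nonpos_iff.1 hle)

/-! ### Inequalities in one variable -/

lemma abs_axisCoord {m : ℝ} (h0 : 0 < m) (h1 : m < 1) :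
    |axisCoord 1 m| = |2 * m - 1| ∧ |axisCoord 2 m| = (2 * m + 1) / 3 ∧ |axisCoord 3 m| = 2 * m + 1 ∧
    |axisCoord 4 m| = 2 * m + 1 ∧
    |axisCoord 6 m| = |(2 * m + 1) * (1 - 2 * m ^ 2)| / (1 + 2 * m ^ 2) ∧
    |axisCoord 7 m| = |2 - m - 2 * m ^ 2| / (2 - m) ∧ |axisCoord 8 m| = 3 - 2 * m ∧
    |axisCoord 9 m| = (2 + m - 2 * m ^ 2) / (2 - m) ∧ |axisCoord 10 m| = 1 := by
  have h2 : 0 < 2 - m := by linarith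
  have h9 : 0 < 2 + m - 2 * m ^ 2 := by nlinarith
  refine ⟨rfl, abs_of_pos (by simp only [axisCoord]; positivity), abs_of_pos (by simp only [axisCoord]; positivity),
    abs_of_pos (by simp only [axisCoord]; positivity), ?_, ?_, abs_of_pos (by simp only [axisCoord]; linarith),
    abs_of_pos (by simp only [axisCoord]; positivity), abs_one⟩
  · rw [axisCoord, abs_div, abs_of_pos (by positivity : 0 < 1 + 2 * m ^ 2)]
  · rw [axisCoord, abs_div, abs_of_pos h2]

lemma axisCoord_1_le_2 (m : ℝ) (h0 : 0 < m) (h1 : m < 1) :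
    1 * |axisCoord 1 m| ≤ 3 * |axisCoord 2 m| := by
  obtain ⟨e1, e2, e3, e4, e6, e7, e8, e9, e10⟩ := abs_axisCoord h0 h1
  have h2 : 0 < 2 - m := by linarith
  have hm2 := mul_pos h0 (sub_pos.2 h1)
  rw [e1, e2]
  field_simp
  rcases abs_cases (2 * m - 1) with h | h <;> nlinarith

lemma axisCoord_1_le_3 (m : ℝ) (h0 : 0 < m) (h1 : m < 1) :
    1 * |axisCoord 1 m| ≤ 1 * |axisCoord 3 m| := by
  obtain ⟨e1, e2, e3, e4, e6, e7, e8, e9, e10⟩ := abs_axisCoord h0 h1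
  have h2 : 0 < 2 - m := by linarith
  have hm2 := mul_pos h0 (sub_pos.2 h1)
  rw [e1, e3]
  rcases abs_cases (2 * m - 1) with h | h <;> nlinarith

lemma axisCoord_1_le_8 (m : ℝ) (h0 : 0 < m) (h1 : m < 1) :
    1 * |axisCoord 1 m| ≤ 1 * |axisCoord 8 m| := by
  obtain ⟨e1, e2, e3, e4, e6, e7, e8, e9, e10⟩ := abs_axisCoord h0 h1
  have h2 : 0 < 2 - m := by linarith
  have hm2 := mul_pos h0 (sub_pos.2 h1)
  rw [e1, e8]
  rcases abs_cases (2 * m - 1) with h | h <;> nlinarith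

lemma axisCoord_1_le_9 (m : ℝ) (h0 : 0 < m) (h1 : m < 1) :
    1 * |axisCoord 1 m| ≤ 1 * |axisCoord 9 m| := by
  obtain ⟨e1, e2, e3, e4, e6, e7, e8, e9, e10⟩ := abs_axisCoord h0 h1
  have h2 : 0 < 2 - m := by linarith
  have hm2 := mul_pos h0 (sub_pos.2 h1)
  rw [e1, e9]
  field_simp
  rcases abs_cases (2 * m - 1) with h | h <;> nlinarith

lemma axisCoord_1_le_10 (m : ℝ) (h0 : 0 < m) (h1 : m < 1) :
    1 * |axisCoord 1 m| ≤ 1 * |axisCoord 10 m| := by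
  obtain ⟨e1, e2, e3, e4, e6, e7, e8, e9, e10⟩ := abs_axisCoord h0 h1
  have h2 : 0 < 2 - m := by linarith
  have hm2 := mul_pos h0 (sub_pos.2 h1)
  rw [e1, e10]
  rcases abs_cases (2 * m - 1) with h | h <;> nlinarith

lemma axisCoord_2_le_8 (m : ℝ) (h0 : 0 < m) (h1 : m < 1) :
    1 * |axisCoord 2 m| ≤ 1 * |axisCoord 8 m| := by
  obtain ⟨e1, e2, e3, e4, e6, e7, e8, e9, e10⟩ := abs_axisCoord h0 h1
  have h2 : 0 < 2 - m := by linarith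
  have hm2 := mul_pos h0 (sub_pos.2 h1)
  rw [e2, e8]
  field_simp
  nlinarith

lemma axisCoord_2_le_9 (m : ℝ) (h0 : 0 < m) (h1 : m < 1) :
    1 * |axisCoord 2 m| ≤ 1 * |axisCoord 9 m| := by
  obtain ⟨e1, e2, e3, e4, e6, e7, e8, e9, e10⟩ := abs_axisCoord h0 h1
  have h2 : 0 < 2 - m := by linarith
  have hm2 := mul_pos h0 (sub_pos.2 h1)
  rw [e2, e9]
  field_simp
  nlinarith

lemma axisCoord_2_le_10 (m : ℝ) (h0 : 0 < m) (h1 : m < 1) :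
    1 * |axisCoord 2 m| ≤ 1 * |axisCoord 10 m| := by
  obtain ⟨e1, e2, e3, e4, e6, e7, e8, e9, e10⟩ := abs_axisCoord h0 h1
  have h2 : 0 < 2 - m := by linarith
  have hm2 := mul_pos h0 (sub_pos.2 h1)
  rw [e2, e10]
  field_simp
  nlinarith

lemma axisCoord_3_le_8 (m : ℝ) (h0 : 0 < m) (h1 : m < 1) :
    1 * |axisCoord 3 m| ≤ 3 * |axisCoord 8 m| := by
  obtain ⟨e1, e2, e3, e4, e6, e7, e8, e9, e10⟩ := abs_axisCoord h0 h1
  have h2 : 0 < 2 - m := by linarith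
  have hm2 := mul_pos h0 (sub_pos.2 h1)
  rw [e3, e8]
  nlinarith

lemma axisCoord_3_le_9 (m : ℝ) (h0 : 0 < m) (h1 : m < 1) :
    1 * |axisCoord 3 m| ≤ 3 * |axisCoord 9 m| := by
  obtain ⟨e1, e2, e3, e4, e6, e7, e8, e9, e10⟩ := abs_axisCoord h0 h1
  have h2 : 0 < 2 - m := by linarith
  have hm2 := mul_pos h0 (sub_pos.2 h1)
  rw [e3, e9]
  field_simp
  nlinarith

lemma axisCoord_3_le_10 (m : ℝ) (h0 : 0 < m) (h1 : m < 1) :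
    1 * |axisCoord 3 m| ≤ 3 * |axisCoord 10 m| := by
  obtain ⟨e1, e2, e3, e4, e6, e7, e8, e9, e10⟩ := abs_axisCoord h0 h1
  have h2 : 0 < 2 - m := by linarith
  have hm2 := mul_pos h0 (sub_pos.2 h1)
  rw [e3, e10]
  nlinarith

lemma axisCoord_6_le_8 (m : ℝ) (h0 : 0 < m) (h1 : m < 1) :
    1 * |axisCoord 6 m| ≤ 1 * |axisCoord 8 m| := by
  obtain ⟨e1, e2, e3, e4, e6, e7, e8, e9, e10⟩ := abs_axisCoord h0 h1
  have h2 : 0 < 2 - m := by linarith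
  have hm2 := mul_pos h0 (sub_pos.2 h1)
  rw [e6, e8]
  field_simp
  rcases abs_cases ((2 * m + 1) * (1 - 2 * m ^ 2)) with h | h <;> nlinarith

lemma axisCoord_7_le_8 (m : ℝ) (h0 : 0 < m) (h1 : m < 1) :
    1 * |axisCoord 7 m| ≤ 1 * |axisCoord 8 m| := by
  obtain ⟨e1, e2, e3, e4, e6, e7, e8, e9, e10⟩ := abs_axisCoord h0 h1
  have h2 : 0 < 2 - m := by linarith
  have hm2 := mul_pos h0 (sub_pos.2 h1)
  rw [e7, e8]
  field_simp
  rcases abs_cases (2 - m - 2 * m ^ 2) with h | h <;> nlinarith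

lemma axisCoord_7_le_9 (m : ℝ) (h0 : 0 < m) (h1 : m < 1) :
    1 * |axisCoord 7 m| ≤ 1 * |axisCoord 9 m| := by
  obtain ⟨e1, e2, e3, e4, e6, e7, e8, e9, e10⟩ := abs_axisCoord h0 h1
  have h2 : 0 < 2 - m := by linarith
  have hm2 := mul_pos h0 (sub_pos.2 h1)
  rw [e7, e9]
  field_simp
  rcases abs_cases (2 - m - 2 * m ^ 2) with h | h <;> nlinarith

lemma axisCoord_7_le_10 (m : ℝ) (h0 : 0 < m) (h1 : m < 1) :
    1 * |axisCoord 7 m| ≤ 1 * |axisCoord 10 m| := by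
  obtain ⟨e1, e2, e3, e4, e6, e7, e8, e9, e10⟩ := abs_axisCoord h0 h1
  have h2 : 0 < 2 - m := by linarith
  have hm2 := mul_pos h0 (sub_pos.2 h1)
  rw [e7, e10]
  field_simp
  rcases abs_cases (2 - m - 2 * m ^ 2) with h | h <;> nlinarith

lemma axisCoord_8_le_9 (m : ℝ) (h0 : 0 < m) (h1 : m < 1) :
    1 * |axisCoord 8 m| ≤ 3 * |axisCoord 9 m| := by
  obtain ⟨e1, e2, e3, e4, e6, e7, e8, e9, e10⟩ := abs_axisCoord h0 h1
  have h2 : 0 < 2 - m := by linarith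
  have hm2 := mul_pos h0 (sub_pos.2 h1)
  rw [e8, e9]
  field_simp
  nlinarith

lemma axisCoord_8_le_10 (m : ℝ) (h0 : 0 < m) (h1 : m < 1) :
    1 * |axisCoord 8 m| ≤ 3 * |axisCoord 10 m| := by
  obtain ⟨e1, e2, e3, e4, e6, e7, e8, e9, e10⟩ := abs_axisCoord h0 h1
  have h2 : 0 < 2 - m := by linarith
  have hm2 := mul_pos h0 (sub_pos.2 h1)
  rw [e8, e10]
  nlinarith

lemma axisCoord_9_le_10 (m : ℝ) (h0 : 0 < m) (h1 : m < 1) :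
    1 * |axisCoord 9 m| ≤ (7 - 4 * √2) * |axisCoord 10 m| := by
  obtain ⟨e1, e2, e3, e4, e6, e7, e8, e9, e10⟩ := abs_axisCoord h0 h1
  have h2 : 0 < 2 - m := by linarith
  have hm2 := mul_pos h0 (sub_pos.2 h1)
  have hs := Real.sq_sqrt (zero_le_two (α := ℝ))
  rw [e9, e10]
  field_simp
  -- The difference of the two sides is exactly `2 * (m - (2 - √2)) ^ 2`.
  nlinarith [sq_nonneg (m - (2 - √2))]

lemma axisCoord_2_ge_6 (m : ℝ) (h0 : 0 < m) (h1 : m < 1) :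
    (1 / 3) * |axisCoord 6 m| ≤ 1 * |axisCoord 2 m| := by
  obtain ⟨e1, e2, e3, e4, e6, e7, e8, e9, e10⟩ := abs_axisCoord h0 h1
  have h2 : 0 < 2 - m := by linarith
  have hm2 := mul_pos h0 (sub_pos.2 h1)
  rw [e2, e6]
  field_simp
  rcases abs_cases ((2 * m + 1) * (1 - 2 * m ^ 2)) with h | h <;> nlinarith

lemma axisCoord_2_ge_7 (m : ℝ) (h0 : 0 < m) (h1 : m < 1) :
    (1 / 3) * |axisCoord 7 m| ≤ 1 * |axisCoord 2 m| := by
  obtain ⟨e1, e2, e3, e4, e6, e7, e8, e9, e10⟩ := abs_axisCoord h0 h1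
  have h2 : 0 < 2 - m := by linarith
  have hm2 := mul_pos h0 (sub_pos.2 h1)
  rw [e2, e7]
  field_simp
  rcases abs_cases (2 - m - 2 * m ^ 2) with h | h <;> nlinarith

lemma axisCoord_2_ge_8 (m : ℝ) (h0 : 0 < m) (h1 : m < 1) :
    (1 / 9) * |axisCoord 8 m| ≤ 1 * |axisCoord 2 m| := by
  obtain ⟨e1, e2, e3, e4, e6, e7, e8, e9, e10⟩ := abs_axisCoord h0 h1
  have h2 : 0 < 2 - m := by linarith
  have hm2 := mul_pos h0 (sub_pos.2 h1)
  rw [e2, e8]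
  field_simp
  nlinarith

lemma axisCoord_2_ge_9 (m : ℝ) (h0 : 0 < m) (h1 : m < 1) :
    (1 / 3) * |axisCoord 9 m| ≤ 1 * |axisCoord 2 m| := by
  obtain ⟨e1, e2, e3, e4, e6, e7, e8, e9, e10⟩ := abs_axisCoord h0 h1
  have h2 : 0 < 2 - m := by linarith
  have hm2 := mul_pos h0 (sub_pos.2 h1)
  rw [e2, e9]
  field_simp
  nlinarith

lemma axisCoord_2_ge_10 (m : ℝ) (h0 : 0 < m) (h1 : m < 1) :
    (1 / 3) * |axisCoord 10 m| ≤ 1 * |axisCoord 2 m| := by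
  obtain ⟨e1, e2, e3, e4, e6, e7, e8, e9, e10⟩ := abs_axisCoord h0 h1
  have h2 : 0 < 2 - m := by linarith
  have hm2 := mul_pos h0 (sub_pos.2 h1)
  rw [e2, e10]
  field_simp
  nlinarith

lemma axisCoord_3_ge_6 (m : ℝ) (h0 : 0 < m) (h1 : m < 1) :
    1 * |axisCoord 6 m| ≤ 1 * |axisCoord 3 m| := by
  obtain ⟨e1, e2, e3, e4, e6, e7, e8, e9, e10⟩ := abs_axisCoord h0 h1
  have h2 : 0 < 2 - m := by linarith
  have hm2 := mul_pos h0 (sub_pos.2 h1)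
  rw [e3, e6]
  field_simp
  rcases abs_cases ((2 * m + 1) * (1 - 2 * m ^ 2)) with h | h <;> nlinarith

lemma axisCoord_3_ge_7 (m : ℝ) (h0 : 0 < m) (h1 : m < 1) :
    1 * |axisCoord 7 m| ≤ 1 * |axisCoord 3 m| := by
  obtain ⟨e1, e2, e3, e4, e6, e7, e8, e9, e10⟩ := abs_axisCoord h0 h1
  have h2 : 0 < 2 - m := by linarith
  have hm2 := mul_pos h0 (sub_pos.2 h1)
  rw [e3, e7]
  field_simp
  rcases abs_cases (2 - m - 2 * m ^ 2) with h | h <;> nlinarith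

lemma axisCoord_3_ge_8 (m : ℝ) (h0 : 0 < m) (h1 : m < 1) :
    (1 / 3) * |axisCoord 8 m| ≤ 1 * |axisCoord 3 m| := by
  obtain ⟨e1, e2, e3, e4, e6, e7, e8, e9, e10⟩ := abs_axisCoord h0 h1
  have h2 : 0 < 2 - m := by linarith
  have hm2 := mul_pos h0 (sub_pos.2 h1)
  rw [e3, e8]
  nlinarith

lemma axisCoord_3_ge_9 (m : ℝ) (h0 : 0 < m) (h1 : m < 1) :
    1 * |axisCoord 9 m| ≤ 1 * |axisCoord 3 m| := by
  obtain ⟨e1, e2, e3, e4, e6, e7, e8, e9, e10⟩ := abs_axisCoord h0 h1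
  have h2 : 0 < 2 - m := by linarith
  have hm2 := mul_pos h0 (sub_pos.2 h1)
  rw [e3, e9]
  field_simp
  nlinarith

lemma axisCoord_3_ge_10 (m : ℝ) (h0 : 0 < m) (h1 : m < 1) :
    1 * |axisCoord 10 m| ≤ 1 * |axisCoord 3 m| := by
  obtain ⟨e1, e2, e3, e4, e6, e7, e8, e9, e10⟩ := abs_axisCoord h0 h1
  have h2 : 0 < 2 - m := by linarith
  have hm2 := mul_pos h0 (sub_pos.2 h1)
  rw [e3, e10]
  nlinarith

lemma axisCoord_8_ge_9 (m : ℝ) (h0 : 0 < m) (h1 : m < 1) :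
    1 * |axisCoord 9 m| ≤ 1 * |axisCoord 8 m| := by
  obtain ⟨e1, e2, e3, e4, e6, e7, e8, e9, e10⟩ := abs_axisCoord h0 h1
  have h2 : 0 < 2 - m := by linarith
  have hm2 := mul_pos h0 (sub_pos.2 h1)
  rw [e8, e9]
  field_simp
  nlinarith

lemma axisCoord_8_ge_10 (m : ℝ) (h0 : 0 < m) (h1 : m < 1) :
    1 * |axisCoord 10 m| ≤ 1 * |axisCoord 8 m| := by
  obtain ⟨e1, e2, e3, e4, e6, e7, e8, e9, e10⟩ := abs_axisCoord h0 h1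
  have h2 : 0 < 2 - m := by linarith
  have hm2 := mul_pos h0 (sub_pos.2 h1)
  rw [e8, e10]
  nlinarith

lemma axisCoord_9_ge_10 (m : ℝ) (h0 : 0 < m) (h1 : m < 1) :
    1 * |axisCoord 10 m| ≤ 1 * |axisCoord 9 m| := by
  obtain ⟨e1, e2, e3, e4, e6, e7, e8, e9, e10⟩ := abs_axisCoord h0 h1
  have h2 : 0 < 2 - m := by linarith
  have hm2 := mul_pos h0 (sub_pos.2 h1)
  rw [e9, e10]
  field_simp
  nlinarith

/-! ### Zeros of the axis coordinates and the resulting bounds -/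

lemma axisCoord_ne_zero {n : ℕ} (hn : n ∈ ({2, 3, 4, 8, 9, 10} : Finset ℕ)) {a : ℝ} (h0 : 0 ≤ a) (h1 : a ≤ 1) :
    axisCoord n a ≠ 0 := by
  have h2 : 0 < 2 - a := by linarith
  have h9 : 0 < 2 + a - 2 * a ^ 2 := by nlinarith
  have h8 : 0 < 3 - 2 * a := by linarith
  simp only [Finset.mem_insert, Finset.mem_singleton] at hn
  rcases hn with rfl | rfl | rfl | rfl | rfl | rfl <;> simp only [axisCoord] <;> positivity

/-- The symmedian point of an isosceles right triangle is its nine-point center. -/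
lemma exists_axisCoord_six_eq_zero : ∃ a : ℝ, 1 / 2 ≤ a ∧ a < 1 ∧ axisCoord 6 a = 0 ∧
    (∀ m : ℝ, a < m → m < 1 → axisCoord 6 m ≠ 0) ∧ axisCoord 1 a ≠ 0 ∧ axisCoord 7 a ≠ 0 := by
  obtain ⟨r, hr0, hr2⟩ : ∃ r : ℝ, 0 ≤ r ∧ r ^ 2 = 2 := ⟨√2, by positivity, by simp⟩
  have hr1 : 7 / 5 < r := by nlinarith
  have hr3 : r < 3 / 2 := by nlinarith
  refine ⟨r / 2, by linarith, by linarith, ?_, fun m h0 h1 => ?_, ?_, ?_⟩ <;> simp only [axisCoord]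
  · rw [show 1 - 2 * (r / 2) ^ 2 = 0 by linarith, mul_zero, zero_div]
  · refine div_ne_zero (mul_ne_zero (by linarith) ?_) (by positivity)
    nlinarith
  · linarith
  · exact div_ne_zero (by nlinarith) (by linarith)

/-- The zero is `(√17 - 1) / 4`, the positive root of `2 - m - 2 * m ^ 2`; there the Gergonne point
is the nine-point center. -/
lemma exists_axisCoord_seven_eq_zero : ∃ a : ℝ, 1 / 2 ≤ a ∧ a < 1 ∧ axisCoord 7 a = 0 ∧
    (∀ m : ℝ, a < m → m < 1 → axisCoord 7 m ≠ 0) ∧ axisCoord 1 a ≠ 0 ∧ axisCoord 6 a ≠ 0 := by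
  obtain ⟨t, ht0, ht2⟩ : ∃ t : ℝ, 0 ≤ t ∧ t ^ 2 = 17 := ⟨√17, by positivity, by simp⟩
  have ht1 : 4 < t := by nlinarith
  have ht3 : t < 5 := by nlinarith
  refine ⟨(t - 1) / 4, by linarith, by linarith, ?_, fun m h0 h1 => ?_, ?_, ?_⟩ <;> simp only [axisCoord]
  · rw [show 2 - (t - 1) / 4 - 2 * ((t - 1) / 4) ^ 2 = 0 by linarith, zero_div]
  · exact div_ne_zero (by nlinarith) (by linarith)
  · linarith
  · exact div_ne_zero (mul_ne_zero (by linarith) (by nlinarith)) (by positivity)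

lemma noUpper_six {i : ℕ} (hi : i ∈ ({1, 2, 3, 4} : Finset ℕ)) : NoUpper 5 i 6 := by
  obtain ⟨a, h0, h1, ha, ha', h1a, -⟩ := exists_axisCoord_six_eq_zero
  have h : i ∈ centerIndices ∧ (i = 1 ∨ i ∈ ({2, 3, 4, 8, 9, 10} : Finset ℕ)) := by
    revert hi
    simp only [centerIndices, Finset.mem_insert, Finset.mem_singleton]
    omega
  refine noUpper_of_axisCoord h.1 (by decide) h0 h1 ha ha' ?_
  rcases h.2 with rfl | h
  · exact h1a
  · exact axisCoord_ne_zero h (by linarith) h1.le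

lemma noUpper_seven {i : ℕ} (hi : i ∈ ({1, 2, 3, 4, 6} : Finset ℕ)) : NoUpper 5 i 7 := by
  obtain ⟨a, h0, h1, ha, ha', h1a, h6a⟩ := exists_axisCoord_seven_eq_zero
  have h : i ∈ centerIndices ∧ (i = 1 ∨ i = 6 ∨ i ∈ ({2, 3, 4, 8, 9, 10} : Finset ℕ)) := by
    revert hi
    simp only [centerIndices, Finset.mem_insert, Finset.mem_singleton]
    omega
  refine noUpper_of_axisCoord h.1 (by decide) h0 h1 ha ha' ?_
  rcases h.2 with rfl | rfl | h
  · exact h1a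
  · exact h6a
  · exact axisCoord_ne_zero h (by linarith) h1.le

/-- Near the equilateral triangle the incenter distance vanishes to second order in `2 * m - 1`, the
other distances only to first order. -/
lemma bestLower_one {j : ℕ} (hj : j ∈ centerIndices) (h : axisCoord j (1 / 2) ≠ 0) : BestLower 5 1 j 0 :=
  bestLower_zero_of_axisCoord (by decide) hj (by norm_num) (by norm_num) h (by norm_num [axisCoord])

lemma bestLower_six {j : ℕ} (hj : j ∈ ({7, 8, 9, 10} : Finset ℕ)) : BestLower 5 6 j 0 := by
  obtain ⟨a, h0, h1, ha, -, -, h7a⟩ := exists_axisCoord_six_eq_zero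
  have h : j ∈ centerIndices ∧ (j = 7 ∨ j ∈ ({2, 3, 4, 8, 9, 10} : Finset ℕ)) := by
    revert hj
    simp only [centerIndices, Finset.mem_insert, Finset.mem_singleton]
    omega
  refine bestLower_zero_of_axisCoord (by decide) h.1 (by linarith) h1.le ?_ ha
  rcases h.2 with rfl | h
  · exact h7a
  · exact axisCoord_ne_zero h (by linarith) h1.le

lemma bestLower_seven {j : ℕ} (hj : j ∈ ({8, 9, 10} : Finset ℕ)) : BestLower 5 7 j 0 := by
  obtain ⟨a, h0, h1, ha, -⟩ := exists_axisCoord_seven_eq_zero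
  have h : j ∈ centerIndices ∧ j ∈ ({2, 3, 4, 8, 9, 10} : Finset ℕ) := by
    revert hj
    simp only [centerIndices, Finset.mem_insert, Finset.mem_singleton]
    omega
  exact bestLower_zero_of_axisCoord (by decide) h.1 (by linarith) h1.le
    (axisCoord_ne_zero h.2 (by linarith) h1.le) ha

lemma bestUpper_of_ne_six {i j : ℕ} (hi : i ∈ centerIndices) (hj : j ∈ centerIndices)
    (hi6 : i ≠ 6) (hj6 : j ≠ 6) {M : ℝ} (a : ℝ) (hM : 0 ≤ M)
    (h : ∀ m : ℝ, 0 < m → m < 1 → 1 * |axisCoord i m| ≤ M * |axisCoord j m|) (h0 : 0 ≤ a) (h1 : a ≤ 1)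
    (ha : axisCoord j a ≠ 0) (hMa : |axisCoord i a| = M * |axisCoord j a|) : BestUpper 5 i j M :=
  bestUpper_of_axisCoord hi hj (mul_D_le_of_axisCoord hi hj hi6 hj6 zero_le_one hM h) h0 h1 ha hMa

lemma bestLower_of_ne_six {i j : ℕ} (hi : i ∈ centerIndices) (hj : j ∈ centerIndices)
    (hi6 : i ≠ 6) (hj6 : j ≠ 6) {M : ℝ} (a : ℝ) (hM : 0 ≤ M)
    (h : ∀ m : ℝ, 0 < m → m < 1 → M * |axisCoord j m| ≤ 1 * |axisCoord i m|) (h0 : 0 ≤ a) (h1 : a ≤ 1)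
    (ha : axisCoord j a ≠ 0) (hMa : |axisCoord i a| = M * |axisCoord j a|) : BestLower 5 i j M :=
  bestLower_of_axisCoord hi hj (mul_D_le_of_axisCoord hj hi hj6 hi6 hM zero_le_one h) h0 h1 ha hMa

lemma bestLower_symmedian {i : ℕ} (hi : i ∈ ({2, 3, 4, 9, 10} : Finset ℕ)) {M : ℝ} (hM : 0 ≤ M)
    (h : ∀ m : ℝ, 0 < m → m < 1 → M * |axisCoord 6 m| ≤ 1 * |axisCoord i m|)
    (hMa : |axisCoord i 0| = M * |axisCoord 6 0|) : BestLower 5 i 6 M := by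
  refine bestLower_of_axisCoord ?_ (by decide) (mul_D_six_le_of_axisCoord hi hM zero_le_one h)
    le_rfl zero_le_one (by norm_num [axisCoord]) hMa
  revert hi
  simp only [centerIndices, Finset.mem_insert, Finset.mem_singleton]
  omega

lemma bestUpper_mittenpunkt_spieker : BestUpper 5 9 10 (7 - 4 * √2) := by
  have hs2 : √2 ^ 2 = 2 := by simp
  have hs0 : 0 < √2 := by positivity
  have hs1 : √2 < 3 / 2 := by nlinarith
  have hs3 : 1 < √2 := by nlinarith
  refine bestUpper_of_ne_six (by decide) (by decide) (by decide) (by decide) (2 - √2) (by linarith)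
    axisCoord_9_le_10 (by linarith) (by linarith) (by simp [axisCoord]) ?_
  have h : axisCoord 9 (2 - √2) = 7 - 4 * √2 := by
    simp only [axisCoord]
    rw [div_eq_iff (by linarith)]
    linarith
  rw [h, abs_of_pos (by linarith)]
  simp [axisCoord]

lemma bestUpper_symmedian_mittenpunkt {C k : ℝ} (hC : 0 < C) (hk0 : 0 < k) (hk1 : k < 1 / 4)
    (hk : (2 * k + 1) * (1 - 2 * k ^ 2) * (2 - k) = C * ((1 + 2 * k ^ 2) * (2 + k - 2 * k ^ 2)))
    (h : ∀ m : ℝ, 0 < m → m < 1 → |(2 * m + 1) * (1 - 2 * m ^ 2)| * (2 - m)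
      ≤ C * ((1 + 2 * m ^ 2) * (2 + m - 2 * m ^ 2))) : BestUpper 5 6 9 C := by
  refine bestUpper_of_axisCoord (by decide) (by decide)
    (mul_D_six_le_of_axisCoord (by decide) zero_le_one hC.le (fun m h0 h1 => ?_)) hk0.le (by linarith)
    (axisCoord_ne_zero (by decide) hk0.le (by linarith)) ?_
  · obtain ⟨-, -, -, -, e6, -, -, e9, -⟩ := abs_axisCoord h0 h1
    have h2 : 0 < 2 - m := by linarith
    have := h m h0 h1
    rw [one_mul, e6, e9, mul_div_assoc', div_le_div_iff₀ (by positivity) h2]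
    linarith
  · obtain ⟨-, -, -, -, e6, -, -, e9, -⟩ := abs_axisCoord hk0 (by linarith)
    have h2 : 0 < 2 - k := by linarith
    have hn : 0 ≤ (2 * k + 1) * (1 - 2 * k ^ 2) := mul_nonneg (by linarith) (by nlinarith)
    rw [e6, e9, abs_of_nonneg hn, mul_div_assoc', div_eq_div_iff (by positivity) h2.ne']
    linarith

lemma bestUpper_symmedian_spieker {C k : ℝ} (hC : 0 < C) (hk0 : 0 < k) (hk1 : k < 1 / 4)
    (hk : (2 * k + 1) * (1 - 2 * k ^ 2) = C * (1 + 2 * k ^ 2))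
    (h : ∀ m : ℝ, 0 < m → m < 1 → |(2 * m + 1) * (1 - 2 * m ^ 2)| ≤ C * (1 + 2 * m ^ 2)) :
    BestUpper 5 6 10 C := by
  refine bestUpper_of_axisCoord (by decide) (by decide)
    (mul_D_six_le_of_axisCoord (by decide) zero_le_one hC.le (fun m h0 h1 => ?_)) hk0.le (by linarith)
    (axisCoord_ne_zero (by decide) hk0.le (by linarith)) ?_
  · obtain ⟨-, -, -, -, e6, -, -, -, e10⟩ := abs_axisCoord h0 h1
    have := h m h0 h1
    rw [one_mul, e6, e10, mul_one, div_le_iff₀ (by positivity)]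
    exact this
  · obtain ⟨-, -, -, -, e6, -, -, -, e10⟩ := abs_axisCoord hk0 (by linarith)
    have hn : 0 ≤ (2 * k + 1) * (1 - 2 * k ^ 2) := mul_nonneg (by linarith) (by nlinarith)
    rw [e6, e10, abs_of_nonneg hn, mul_one, div_eq_iff (by positivity)]
    linarith

lemma constRatio_centroid {j : ℕ} (hj : j ∈ ({3, 4} : Finset ℕ)) : ConstRatio 5 2 j (1 / 3) := by
  simp only [Finset.mem_insert, Finset.mem_singleton] at hj
  rcases hj with rfl | rfl <;>
  · refine constRatio_of_axisCoord (by decide) (by decide) (by decide) (by decide) (by norm_num)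
      (axisCoord_ne_zero (by decide) (by norm_num) (by norm_num)) fun m h0 h1 => ?_
    obtain ⟨-, e2, e3, e4, -⟩ := abs_axisCoord h0 h1
    simp only [e2, e3, e4]
    ring

lemma constRatio_circumcenter_orthocenter : ConstRatio 5 3 4 1 :=
  constRatio_of_axisCoord (by decide) (by decide) (by decide) (by decide) zero_le_one
    (axisCoord_ne_zero (by decide) (by norm_num) (by norm_num)) fun m _ _ => by
      rw [one_mul]
      rfl

end TriangleCenters

open TriangleCenters in
theorem mainTheorem8 :
    ∃ C₄ C₅ : ℝ,
      -- `C₄` and `C₅` are the unique positive roots of their polynomials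
      {x : ℝ | 0 < x ∧ 6137 * x ^ 5 + 5335 * x ^ 4 + 678 * x ^ 3 - 3702 * x ^ 2 - 9479 * x - 1225 = 0}
        = {C₄} ∧
      {x : ℝ | 0 < x ∧ x ^ 4 + 2 * x ^ 3 + 22 * x ^ 2 - 30 * x - 1 = 0} = {C₅} ∧
      |C₄ - 1.053322135| < 1 / 10 ^ 9 ∧ |C₅ - 1.194505073| < 1 / 10 ^ 9 ∧
      (minpoly ℚ C₄).natDegree = 5 ∧ (minpoly ℚ C₅).natDegree = 4 ∧
      -- the bounds
      BestLower 5 1 2 0 ∧ BestUpper 5 1 2 3 ∧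
      BestLower 5 1 3 0 ∧ BestUpper 5 1 3 1 ∧
      BestLower 5 1 4 0 ∧ BestUpper 5 1 4 1 ∧
      BestLower 5 1 6 0 ∧ NoUpper 5 1 6 ∧
      BestLower 5 1 7 0 ∧ NoUpper 5 1 7 ∧
      BestLower 5 1 8 0 ∧ BestUpper 5 1 8 1 ∧
      BestLower 5 1 9 0 ∧ BestUpper 5 1 9 1 ∧
      BestLower 5 1 10 0 ∧ BestUpper 5 1 10 1 ∧
      ConstRatio 5 2 3 (1 / 3) ∧
      ConstRatio 5 2 4 (1 / 3) ∧
      BestLower 5 2 6 (1 / 3) ∧ NoUpper 5 2 6 ∧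
      BestLower 5 2 7 (1 / 3) ∧ NoUpper 5 2 7 ∧
      BestLower 5 2 8 (1 / 9) ∧ BestUpper 5 2 8 1 ∧
      BestLower 5 2 9 (1 / 3) ∧ BestUpper 5 2 9 1 ∧
      BestLower 5 2 10 (1 / 3) ∧ BestUpper 5 2 10 1 ∧
      ConstRatio 5 3 4 1 ∧
      BestLower 5 3 6 1 ∧ NoUpper 5 3 6 ∧
      BestLower 5 3 7 1 ∧ NoUpper 5 3 7 ∧
      BestLower 5 3 8 (1 / 3) ∧ BestUpper 5 3 8 3 ∧
      BestLower 5 3 9 1 ∧ BestUpper 5 3 9 3 ∧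
      BestLower 5 3 10 1 ∧ BestUpper 5 3 10 3 ∧
      BestLower 5 4 6 1 ∧ NoUpper 5 4 6 ∧
      BestLower 5 4 7 1 ∧ NoUpper 5 4 7 ∧
      BestLower 5 4 8 (1 / 3) ∧ BestUpper 5 4 8 3 ∧
      BestLower 5 4 9 1 ∧ BestUpper 5 4 9 3 ∧
      BestLower 5 4 10 1 ∧ BestUpper 5 4 10 3 ∧
      BestLower 5 6 7 0 ∧ NoUpper 5 6 7 ∧
      BestLower 5 6 8 0 ∧ BestUpper 5 6 8 1 ∧
      BestLower 5 6 9 0 ∧ BestUpper 5 6 9 C₄ ∧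
      BestLower 5 6 10 0 ∧ BestUpper 5 6 10 C₅ ∧
      BestLower 5 7 8 0 ∧ BestUpper 5 7 8 1 ∧
      BestLower 5 7 9 0 ∧ BestUpper 5 7 9 1 ∧
      BestLower 5 7 10 0 ∧ BestUpper 5 7 10 1 ∧
      BestLower 5 8 9 1 ∧ BestUpper 5 8 9 3 ∧
      BestLower 5 8 10 1 ∧ BestUpper 5 8 10 3 ∧
      BestLower 5 9 10 1 ∧ BestUpper 5 9 10 (7 - 4 * √2) := by
  obtain ⟨C₄, h4set, h4abs, h4deg, h4pos, ⟨k, hk0, hk1, hk⟩, h4⟩ := exists_symmedian_mittenpunkt_const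
  obtain ⟨C₅, h5set, h5abs, h5deg, h5pos, ⟨l, hl0, hl1, hl⟩, h5⟩ := exists_symmedian_spieker_const
  exact ⟨C₄, C₅, h4set, h5set, h4abs, h5abs, h4deg, h5deg,
    bestLower_one (by decide) (by norm_num [axisCoord]),
    -- The numeral `0` or `1` in these terms is the degenerate apex parameter at which the bound is
    -- approached.
    bestUpper_of_ne_six (by decide) (by decide) (by decide) (by decide) 0 (by norm_num) axisCoord_1_le_2
      le_rfl zero_le_one (by norm_num [axisCoord]) (by norm_num [axisCoord]),
    bestLower_one (by decide) (by norm_num [axisCoord]),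
    bestUpper_of_ne_six (by decide) (by decide) (by decide) (by decide) 0 (by norm_num) axisCoord_1_le_3
      le_rfl zero_le_one (by norm_num [axisCoord]) (by norm_num [axisCoord]),
    bestLower_one (by decide) (by norm_num [axisCoord]),
    -- The circumcenter inequalities serve for the orthocenter too: `axisCoord 3` and `axisCoord 4`
    -- are given by the same formula.
    bestUpper_of_ne_six (by decide) (by decide) (by decide) (by decide) 0 (by norm_num) axisCoord_1_le_3
      le_rfl zero_le_one (by norm_num [axisCoord]) (by norm_num [axisCoord]),
    bestLower_one (by decide) (by norm_num [axisCoord]),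
    noUpper_six (by decide),
    bestLower_one (by decide) (by norm_num [axisCoord]),
    noUpper_seven (by decide),
    bestLower_one (by decide) (by norm_num [axisCoord]),
    bestUpper_of_ne_six (by decide) (by decide) (by decide) (by decide) 1 (by norm_num) axisCoord_1_le_8
      zero_le_one le_rfl (by norm_num [axisCoord]) (by norm_num [axisCoord]),
    bestLower_one (by decide) (by norm_num [axisCoord]),
    bestUpper_of_ne_six (by decide) (by decide) (by decide) (by decide) 1 (by norm_num) axisCoord_1_le_9
      zero_le_one le_rfl (by norm_num [axisCoord]) (by norm_num [axisCoord]),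
    bestLower_one (by decide) (by norm_num [axisCoord]),
    bestUpper_of_ne_six (by decide) (by decide) (by decide) (by decide) 1 (by norm_num) axisCoord_1_le_10
      zero_le_one le_rfl (by norm_num [axisCoord]) (by norm_num [axisCoord]),
    constRatio_centroid (by decide),
    constRatio_centroid (by decide),
    bestLower_symmedian (by decide) (by norm_num) axisCoord_2_ge_6 (by norm_num [axisCoord]),
    noUpper_six (by decide),
    bestLower_of_ne_six (by decide) (by decide) (by decide) (by decide) 0 (by norm_num) axisCoord_2_ge_7
      le_rfl zero_le_one (by norm_num [axisCoord]) (by norm_num [axisCoord]),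
    noUpper_seven (by decide),
    bestLower_of_ne_six (by decide) (by decide) (by decide) (by decide) 0 (by norm_num) axisCoord_2_ge_8
      le_rfl zero_le_one (by norm_num [axisCoord]) (by norm_num [axisCoord]),
    bestUpper_of_ne_six (by decide) (by decide) (by decide) (by decide) 1 (by norm_num) axisCoord_2_le_8
      zero_le_one le_rfl (by norm_num [axisCoord]) (by norm_num [axisCoord]),
    bestLower_of_ne_six (by decide) (by decide) (by decide) (by decide) 0 (by norm_num) axisCoord_2_ge_9
      le_rfl zero_le_one (by norm_num [axisCoord]) (by norm_num [axisCoord]),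
    bestUpper_of_ne_six (by decide) (by decide) (by decide) (by decide) 1 (by norm_num) axisCoord_2_le_9
      zero_le_one le_rfl (by norm_num [axisCoord]) (by norm_num [axisCoord]),
    bestLower_of_ne_six (by decide) (by decide) (by decide) (by decide) 0 (by norm_num) axisCoord_2_ge_10
      le_rfl zero_le_one (by norm_num [axisCoord]) (by norm_num [axisCoord]),
    bestUpper_of_ne_six (by decide) (by decide) (by decide) (by decide) 1 (by norm_num) axisCoord_2_le_10
      zero_le_one le_rfl (by norm_num [axisCoord]) (by norm_num [axisCoord]),
    constRatio_circumcenter_orthocenter,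
    bestLower_symmedian (by decide) (by norm_num) axisCoord_3_ge_6 (by norm_num [axisCoord]),
    noUpper_six (by decide),
    bestLower_of_ne_six (by decide) (by decide) (by decide) (by decide) 0 (by norm_num) axisCoord_3_ge_7
      le_rfl zero_le_one (by norm_num [axisCoord]) (by norm_num [axisCoord]),
    noUpper_seven (by decide),
    bestLower_of_ne_six (by decide) (by decide) (by decide) (by decide) 0 (by norm_num) axisCoord_3_ge_8
      le_rfl zero_le_one (by norm_num [axisCoord]) (by norm_num [axisCoord]),
    bestUpper_of_ne_six (by decide) (by decide) (by decide) (by decide) 1 (by norm_num) axisCoord_3_le_8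
      zero_le_one le_rfl (by norm_num [axisCoord]) (by norm_num [axisCoord]),
    bestLower_of_ne_six (by decide) (by decide) (by decide) (by decide) 0 (by norm_num) axisCoord_3_ge_9
      le_rfl zero_le_one (by norm_num [axisCoord]) (by norm_num [axisCoord]),
    bestUpper_of_ne_six (by decide) (by decide) (by decide) (by decide) 1 (by norm_num) axisCoord_3_le_9
      zero_le_one le_rfl (by norm_num [axisCoord]) (by norm_num [axisCoord]),
    bestLower_of_ne_six (by decide) (by decide) (by decide) (by decide) 0 (by norm_num) axisCoord_3_ge_10
      le_rfl zero_le_one (by norm_num [axisCoord]) (by norm_num [axisCoord]),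
    bestUpper_of_ne_six (by decide) (by decide) (by decide) (by decide) 1 (by norm_num) axisCoord_3_le_10
      zero_le_one le_rfl (by norm_num [axisCoord]) (by norm_num [axisCoord]),
    bestLower_symmedian (by decide) (by norm_num) axisCoord_3_ge_6 (by norm_num [axisCoord]),
    noUpper_six (by decide),
    bestLower_of_ne_six (by decide) (by decide) (by decide) (by decide) 0 (by norm_num) axisCoord_3_ge_7
      le_rfl zero_le_one (by norm_num [axisCoord]) (by norm_num [axisCoord]),
    noUpper_seven (by decide),
    bestLower_of_ne_six (by decide) (by decide) (by decide) (by decide) 0 (by norm_num) axisCoord_3_ge_8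
      le_rfl zero_le_one (by norm_num [axisCoord]) (by norm_num [axisCoord]),
    bestUpper_of_ne_six (by decide) (by decide) (by decide) (by decide) 1 (by norm_num) axisCoord_3_le_8
      zero_le_one le_rfl (by norm_num [axisCoord]) (by norm_num [axisCoord]),
    bestLower_of_ne_six (by decide) (by decide) (by decide) (by decide) 0 (by norm_num) axisCoord_3_ge_9
      le_rfl zero_le_one (by norm_num [axisCoord]) (by norm_num [axisCoord]),
    bestUpper_of_ne_six (by decide) (by decide) (by decide) (by decide) 1 (by norm_num) axisCoord_3_le_9
      zero_le_one le_rfl (by norm_num [axisCoord]) (by norm_num [axisCoord]),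
    bestLower_of_ne_six (by decide) (by decide) (by decide) (by decide) 0 (by norm_num) axisCoord_3_ge_10
      le_rfl zero_le_one (by norm_num [axisCoord]) (by norm_num [axisCoord]),
    bestUpper_of_ne_six (by decide) (by decide) (by decide) (by decide) 1 (by norm_num) axisCoord_3_le_10
      zero_le_one le_rfl (by norm_num [axisCoord]) (by norm_num [axisCoord]),
    bestLower_six (by decide),
    noUpper_seven (by decide),
    bestLower_six (by decide),
    bestUpper_of_axisCoord (by decide) (by decide) (D_six_le_D_eight axisCoord_6_le_8)
      zero_le_one le_rfl (by norm_num [axisCoord]) (by norm_num [axisCoord]),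
    bestLower_six (by decide),
    bestUpper_symmedian_mittenpunkt h4pos hk0 hk1 hk h4,
    bestLower_six (by decide),
    bestUpper_symmedian_spieker h5pos hl0 hl1 hl h5,
    bestLower_seven (by decide),
    bestUpper_of_ne_six (by decide) (by decide) (by decide) (by decide) 1 (by norm_num) axisCoord_7_le_8
      zero_le_one le_rfl (by norm_num [axisCoord]) (by norm_num [axisCoord]),
    bestLower_seven (by decide),
    bestUpper_of_ne_six (by decide) (by decide) (by decide) (by decide) 0 (by norm_num) axisCoord_7_le_9
      le_rfl zero_le_one (by norm_num [axisCoord]) (by norm_num [axisCoord]),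
    bestLower_seven (by decide),
    bestUpper_of_ne_six (by decide) (by decide) (by decide) (by decide) 0 (by norm_num) axisCoord_7_le_10
      le_rfl zero_le_one (by norm_num [axisCoord]) (by norm_num [axisCoord]),
    bestLower_of_ne_six (by decide) (by decide) (by decide) (by decide) 1 (by norm_num) axisCoord_8_ge_9
      zero_le_one le_rfl (by norm_num [axisCoord]) (by norm_num [axisCoord]),
    bestUpper_of_ne_six (by decide) (by decide) (by decide) (by decide) 0 (by norm_num) axisCoord_8_le_9
      le_rfl zero_le_one (by norm_num [axisCoord]) (by norm_num [axisCoord]),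
    bestLower_of_ne_six (by decide) (by decide) (by decide) (by decide) 1 (by norm_num) axisCoord_8_ge_10
      zero_le_one le_rfl (by norm_num [axisCoord]) (by norm_num [axisCoord]),
    bestUpper_of_ne_six (by decide) (by decide) (by decide) (by decide) 0 (by norm_num) axisCoord_8_le_10
      le_rfl zero_le_one (by norm_num [axisCoord]) (by norm_num [axisCoord]),
    bestLower_of_ne_six (by decide) (by decide) (by decide) (by decide) 0 (by norm_num) axisCoord_9_ge_10
      le_rfl zero_le_one (by norm_num [axisCoord]) (by norm_num [axisCoord]),
    bestUpper_mittenpunkt_spieker⟩
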